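/- Let $\mathcal A$ be a complex algebra, $\sigma$ an automorphism of $\mathcal A$, and let $(\mathcal A,\mathfrak H,D)$ be a graded $\sigma$-spectral triple: $\mathcal A$ acts by bounded operators on the Hilbert space $\mathfrak H$; $D$ is a self-adjoint operator on $\mathfrak H$ with compact resolvent; every $a\in\mathcal A$ preserves $\mathrm{Dom}\,D$ and $Da-\sigma(a)D$ is bounded; and there is an operator $\gamma=\gamma^*$ with $\gamma^2=I$ which commutes with $\mathcal A$, preserves $\mathrm{Dom}\,D$ and satisfies $D\gamma=-\gamma D$. Assume that $D$ is invertible, with $D^{-1}\in\mathcal L^{n,\infty}$ for some even integer $n\ge 2$, i.e. $D^{-1}$ is compact with characteristic values $\mu_k(D^{-1})=O(k^{-1/n})$. Let $\mathfrak H_\pm=\ker(\gamma\mp I)$, let $a_\pm$ be the restriction of $a\in\mathcal A$ to $\mathfrak H_\pm$, and let $D_\pm:\mathfrak H_\pm\to\mathfrak H_\mp$ be the restriction of $D$ to $\mathrm{Dom}\,D\cap\mathfrak H_\pm$. For $a^0,\dots,a^n\in\mathcal A$ the operator $D_\pm^{-1}(D_\pm a^0_\pm-\sigma(a^0_\mp)D_\pm)\cdots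 D_\pm^{-1}(D_\pm a^n_\pm-\sigma(a^n_\mp)D_\pm)$ on $\mathfrak H_\pm$ (where $D_\pm a_\pm-\sigma(a_\mp)D_\pm$ stands for its bounded closure, and $\sigma(a_\mp)$ for $\sigma(a)_\mp$) is of trace class; write $$\Phi^\pm_{D,\sigma}(a^0,\dots,a^n)=\mathrm{Tr}\big(D_\pm^{-1}(D_\pm a^0_\pm-\sigma(a^0_\mp)D_\pm)\cdots D_\pm^{-1}(D_\pm a^n_\pm-\sigma(a^n_\mp)D_\pm)\big),$$ and extend $\Phi^\pm_{D,\sigma}$ to matrices by $\Phi^\pm_{D,\sigma}(E^0,\dots,E^n)=\sum_{i_0,\dots,i_n=1}^N\Phi^\pm_{D,\sigma}(E^0_{i_0i_1},E^1_{i_1i_2},\dots,E^n_{i_ni_0})$ for $E^0,\dots,E^n\in M_N(\mathcal A)$. Let $e=e^2\in M_N(\mathcal A)$. Let $e_\pm$ be the operator given by $e$ on $\mathfrak H_\pm\otimes\mathbb C^N$, and let $f_\pm$ be the bounded closure of $D_\pm^{-1}\sigma(e_\mp)D_\pm$ on $\mathfrak H_\pm\otimes\mathbb C^N$ ($\sigma$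 and $D_\pm$ being applied entrywise). Then the operator $f_\pm e_\pm: e_\pm(\mathfrak H_\pm\otimes\mathbb C^N)\to f_\pm(\mathfrak H_\pm\otimes\mathbb C^N)$ is Fredholm, and its index $\mathrm{Index}^\pm_{D,\sigma}[e]=\dim\ker(f_\pm e_\pm)-\dim\mathrm{coker}(f_\pm e_\pm)$ satisfies $$\mathrm{Index}^\pm_{D,\sigma}[e]=\Phi^\pm_{D,\sigma}(e,\dots,e).$$ Suppose moreover that $\mathcal A$ is an involutive algebra, that its representation on $\mathfrak H$ is involutive, and that $\sigma(a^*)=(\sigma^{-1}(a))^*$ for all $a\in\mathcal A$. If in addition $e^*=\sigma(e)$ in $M_N(\mathcal A)$, then $$\mathrm{Index}^+_{D,\sigma}[e]=-\,\mathrm{Index}^-_{D,\sigma}[e].$$ -/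

import Mathlib

open scoped Matrix

noncomputable section

namespace SigmaTriple

/-! ### Bounded operators: characteristic values, ideals, trace -/

section Operators

variable {E F : Type*} [NormedAddCommGroup E] [NormedSpace ℂ E]
  [NormedAddCommGroup F] [NormedSpace ℂ F]

/-- The `k`-th characteristic value `μ_k(T)` (with `k = 0, 1, 2, …`): the distance, in operator
norm, from `T` to the operators of rank at most `k`. -/
def charValue (T : E →L[ℂ] F) (k : ℕ) : ℝ :=
  sInf {r : ℝ | ∃ R : E →L[ℂ] F, (R : E →ₗ[ℂ] F).rank ≤ (k : Cardinal) ∧ r = ‖T - R‖}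

/-- The ideal `𝓛^{p,∞}` for `p > 1`: compact operators with `μ_k(T) = O(k^{-1/p})`. -/
def MemWeakSchatten (p : ℝ) (T : E →L[ℂ] F) : Prop :=
  IsCompactOperator T ∧ ∃ C : ℝ, ∀ k : ℕ, charValue T k ≤ C * ((k : ℝ) + 1) ^ (-(1 / p))

/-- Trace class operators: compact operators with `∑ μ_k(T) < ∞`. -/
def IsTraceClass (T : E →L[ℂ] E) : Prop :=
  IsCompactOperator T ∧ Summable (charValue T)

end Operators

section Trace

variable {E : Type*} [NormedAddCommGroup E] [InnerProductSpace ℂ E] [CompleteSpace E]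

/-- The index set of some orthonormal (Hilbert) basis of `E`. -/
def basisIndex (E : Type*) [NormedAddCommGroup E] [InnerProductSpace ℂ E] [CompleteSpace E] :
    Set E :=
  (exists_hilbertBasis ℂ E).choose

/-- Some orthonormal (Hilbert) basis of `E`. -/
def hilbertBasis (E : Type*) [NormedAddCommGroup E] [InnerProductSpace ℂ E] [CompleteSpace E] :
    HilbertBasis (basisIndex E) ℂ E :=
  (exists_hilbertBasis ℂ E).choose_spec.choose

/-- The trace `Tr T = ∑ ⟨b i, T (b i)⟩` in an orthonormal basis; for trace class operators the
series converges absolutely and the sum does not depend on the basis. -/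
def trace (T : E →L[ℂ] E) : ℂ :=
  ∑' i, inner ℂ (hilbertBasis E i) (T (hilbertBasis E i))

end Trace

/-! ### Bounded closures and inverses of partially defined operators -/

section BddClosure

variable {E F : Type*} [NormedAddCommGroup E] [NormedSpace ℂ E]
  [NormedAddCommGroup F] [NormedSpace ℂ F] [CompleteSpace F]

/-- The bounded closure of a densely defined bounded operator: its unique continuous extension to
the whole space (see `bddClosure_apply`, `bddClosure_unique`). -/
def bddClosure (T : E →ₗ.[ℂ] F) : E →L[ℂ] F :=
  T.toFun.extendOfNorm T.domain.subtypeL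

theorem bddClosure_apply (T : E →ₗ.[ℂ] F) (hd : Dense (T.domain : Set E))
    (hb : ∃ C : ℝ, ∀ x : T.domain, ‖T x‖ ≤ C * ‖(x : E)‖) (x : T.domain) :
    bddClosure T (x : E) = T x := by
  have h1 : DenseRange T.domain.subtypeL := by
    have : Set.range T.domain.subtypeL = (T.domain : Set E) := by
      ext y; simp
    rw [DenseRange, this]; exact hd
  have h2 : ∃ C : ℝ, ∀ x : T.domain, ‖T.toFun x‖ ≤ C * ‖T.domain.subtypeL x‖ := hb
  have h3 := LinearMap.extendOfNorm_eq h1 h2 x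
  exact h3

theorem bddClosure_unique (T : E →ₗ.[ℂ] F) (hd : Dense (T.domain : Set E))
    (hb : ∃ C : ℝ, ∀ x : T.domain, ‖T x‖ ≤ C * ‖(x : E)‖) (S : E →L[ℂ] F)
    (hS : ∀ x : T.domain, S (x : E) = T x) : S = bddClosure T := by
  have : (S : E → F) = bddClosure T := by
    refine Continuous.ext_on hd S.continuous (bddClosure T).continuous ?_
    intro x hx
    rw [hS ⟨x, hx⟩, bddClosure_apply T hd hb ⟨x, hx⟩]
  exact DFunLike.coe_injective this

/-- `R` is the (everywhere defined, bounded) inverse `D⁻¹` of the operator `D`. -/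
def IsBoundedInverse (D : E →ₗ.[ℂ] F) (R : F →L[ℂ] E) : Prop :=
  (∀ y : F, ∃ h : R y ∈ D.domain, D ⟨R y, h⟩ = y) ∧ ∀ x : D.domain, R (D x) = x

/-- `R` is the resolvent `(D - z)⁻¹` of the operator `D` at `z`. -/
def IsResolventAt (D : E →ₗ.[ℂ] E) (z : ℂ) (R : E →L[ℂ] E) : Prop :=
  (∀ y : E, ∃ h : R y ∈ D.domain, D ⟨R y, h⟩ - z • R y = y) ∧
    ∀ x : D.domain, R (D x - z • (x : E)) = x

end BddClosure

/-! ### Matrices of operators -/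

/-- The operator on the Hilbert space `E^N = E ⊗ ℂ^N` given by a matrix of operators on `E`. -/
def matOp {E : Type*} [NormedAddCommGroup E] [NormedSpace ℂ E] {N : ℕ}
    (M : Matrix (Fin N) (Fin N) (E →L[ℂ] E)) :
    PiLp 2 (fun _ : Fin N => E) →L[ℂ] PiLp 2 (fun _ : Fin N => E) :=
  ((PiLp.continuousLinearEquiv 2 ℂ (fun _ : Fin N => E)).symm : _ →L[ℂ] _) ∘L
    (ContinuousLinearMap.pi fun i => ∑ j, M i j ∘L ContinuousLinearMap.proj j) ∘L
      ((PiLp.continuousLinearEquiv 2 ℂ (fun _ : Fin N => E)) : _ →L[ℂ] _)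

theorem matOp_apply {E : Type*} [NormedAddCommGroup E] [NormedSpace ℂ E] {N : ℕ}
    (M : Matrix (Fin N) (Fin N) (E →L[ℂ] E)) (x : PiLp 2 (fun _ : Fin N => E)) (i : Fin N) :
    matOp M x i = ∑ j, M i j (x j) := by
  simp [matOp]

/-! ### Graded twisted spectral triples -/

/-- A graded `σ`-spectral triple `(A, H, D)` with grading operator `γ`: `σ` is an automorphism of
the complex algebra `A`, which acts on the Hilbert space `H` through `π`; `D` is a (densely
defined) self-adjoint operator with compact resolvent, and the twisted commutators
`D a - σ(a) D` are defined on the domain of `D` and bounded. -/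
structure GradedSigmaTriple (A H : Type*) [NonUnitalRing A] [Module ℂ A]
    [NormedAddCommGroup H] [InnerProductSpace ℂ H] [CompleteSpace H] where
  σ : A ≃+* A
  σ_smul : ∀ (c : ℂ) (a : A), σ (c • a) = c • σ a
  π : A →ₙₐ[ℂ] (H →L[ℂ] H)
  D : H →ₗ.[ℂ] H
  selfAdjoint_D : IsSelfAdjoint D
  compact_resolvent : ∃ (z : ℂ) (R : H →L[ℂ] H), IsResolventAt D z R ∧ IsCompactOperator R
  π_mem_domain : ∀ (a : A) (x : H), x ∈ D.domain → π a x ∈ D.domain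
  bounded_twisted_commutator : ∀ a : A, ∃ C : ℝ, ∀ x : D.domain,
    ‖D ⟨π a x, π_mem_domain a x x.2⟩ - π (σ a) (D x)‖ ≤ C * ‖(x : H)‖
  γ : H →L[ℂ] H
  selfAdjoint_γ : IsSelfAdjoint γ
  γ_sq : ∀ x : H, γ (γ x) = x
  γ_comm : ∀ (a : A) (x : H), γ (π a x) = π a (γ x)
  γ_mem_domain : ∀ x : H, x ∈ D.domain → γ x ∈ D.domain
  anticomm : ∀ x : D.domain, D ⟨γ x, γ_mem_domain x x.2⟩ = -γ (D x)

namespace GradedSigmaTriple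

variable {A H : Type*} [NonUnitalRing A] [Module ℂ A]
  [NormedAddCommGroup H] [InnerProductSpace ℂ H] [CompleteSpace H]
  (T : GradedSigmaTriple A H)

/-- The subspace `H_±`, the eigenspace of `γ` for the eigenvalue `s = ±1`. -/
def half (s : ℤˣ) : Submodule ℂ H :=
  (T.γ - ((s : ℤ) : ℂ) • ContinuousLinearMap.id ℂ H).ker

theorem mem_half {s : ℤˣ} {x : H} : x ∈ T.half s ↔ T.γ x = ((s : ℤ) : ℂ) • x := by
  simp [half, sub_eq_zero]

instance (s : ℤˣ) : CompleteSpace (T.half s) := by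
  unfold half; infer_instance

/-- The component `a_±` of the action of `a ∈ A` on `H_±`. -/
def act (s : ℤˣ) (a : A) : T.half s →L[ℂ] T.half s :=
  (T.π a).restrict fun x hx => by
    rw [mem_half] at hx ⊢
    rw [T.γ_comm, hx, map_smul]

/-- The component `D_± : H_± → H_∓` of `D`, with domain `Dom D ∩ H_±`. -/
def DPart (s : ℤˣ) : T.half s →ₗ.[ℂ] T.half (-s) where
  domain := T.D.domain.comap (T.half s).subtype
  toFun := LinearMap.codRestrict (T.half (-s))
    (T.D.toFun ∘ₗ ((T.half s).subtype.restrict fun _ hx => hx)) fun x => by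
      have hx : T.γ ((x : T.half s) : H) = ((s : ℤ) : ℂ) • ((x : T.half s) : H) :=
        T.mem_half.1 x.1.2
      have h := T.anticomm ⟨((x : T.half s) : H), x.2⟩
      have h2 : (⟨T.γ ((x : T.half s) : H), T.γ_mem_domain _ x.2⟩ : T.D.domain) =
          ((s : ℤ) : ℂ) • (⟨((x : T.half s) : H), x.2⟩ : T.D.domain) := Subtype.ext hx
      rw [h2, LinearPMap.map_smul] at h
      rw [mem_half]
      change T.γ (T.D ⟨((x : T.half s) : H), x.2⟩) = _ • T.D ⟨((x : T.half s) : H), x.2⟩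
      rw [eq_neg_iff_add_eq_zero, add_comm, ← eq_neg_iff_add_eq_zero] at h
      rw [h]
      simp

theorem DPart_apply (s : ℤˣ) (x : (T.DPart s).domain) :
    (T.DPart s x : H) = T.D ⟨((x : T.half s) : H), x.2⟩ := rfl

theorem act_mem_domain (s : ℤˣ) (a : A) (x : T.half s) (hx : x ∈ (T.DPart s).domain) :
    T.act s a x ∈ (T.DPart s).domain :=
  T.π_mem_domain a x hx

theorem dense_domain (s : ℤˣ) : Dense ((T.DPart s).domain : Set (T.half s)) := by
  have hss : ((s : ℤ) : ℂ) * ((s : ℤ) : ℂ) = 1 := by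
    rcases Int.units_eq_one_or s with rfl | rfl <;> simp
  let P : H →L[ℂ] T.half s :=
    ((1 / 2 : ℂ) • (ContinuousLinearMap.id ℂ H + ((s : ℤ) : ℂ) • T.γ)).codRestrict (T.half s)
      fun x => by
        rw [mem_half]
        change T.γ ((1 / 2 : ℂ) • (x + ((s : ℤ) : ℂ) • T.γ x)) =
          ((s : ℤ) : ℂ) • (1 / 2 : ℂ) • (x + ((s : ℤ) : ℂ) • T.γ x)
        rw [map_smul, map_add, map_smul, T.γ_sq, smul_comm ((s : ℤ) : ℂ) (1 / 2 : ℂ),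
          smul_add ((s : ℤ) : ℂ), smul_smul ((s : ℤ) : ℂ), hss, one_smul, add_comm]
  have hP : ∀ x : T.half s, P x = x := by
    intro x
    apply Subtype.ext
    change (1 / 2 : ℂ) • ((x : H) + ((s : ℤ) : ℂ) • T.γ x) = x
    rw [T.mem_half.1 x.2, smul_smul, hss, one_smul, ← two_smul ℂ (x : H), smul_smul]
    norm_num
  have hsurj : Function.Surjective P := fun x => ⟨x, hP x⟩
  have hd : Dense (P '' (T.D.domain : Set H)) :=
    hsurj.denseRange.dense_image P.continuous T.selfAdjoint_D.dense_domain
  refine hd.mono ?_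
  rintro _ ⟨x, hx, rfl⟩
  exact T.D.domain.smul_mem _
    (T.D.domain.add_mem hx (T.D.domain.smul_mem _ (T.γ_mem_domain x hx)))

/-- The operator `D_± a_± - σ(a_∓) D_± : H_± → H_∓` on the domain of `D_±`. -/
def twistedComm (s : ℤˣ) (a : A) : T.half s →ₗ.[ℂ] T.half (-s) where
  domain := (T.DPart s).domain
  toFun := (T.DPart s).toFun ∘ₗ
      ((T.act s a : T.half s →ₗ[ℂ] T.half s).restrict (T.act_mem_domain s a)) -
    (T.act (-s) (T.σ a) : T.half (-s) →ₗ[ℂ] T.half (-s)) ∘ₗ (T.DPart s).toFun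

/-- The bounded closure of `D_± a_± - σ(a_∓) D_±`. -/
def dσ (s : ℤˣ) (a : A) : T.half s →L[ℂ] T.half (-s) :=
  bddClosure (T.twistedComm s a)

theorem twistedComm_bounded (s : ℤˣ) (a : A) :
    ∃ C : ℝ, ∀ x : (T.twistedComm s a).domain, ‖T.twistedComm s a x‖ ≤ C * ‖(x : T.half s)‖ := by
  obtain ⟨C, hC⟩ := T.bounded_twisted_commutator a
  exact ⟨C, fun x => hC ⟨((x : T.half s) : H), x.2⟩⟩

theorem dσ_apply (s : ℤˣ) (a : A) (x : (T.DPart s).domain) :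
    T.dσ s a (x : T.half s) =
      T.DPart s ⟨T.act s a x, T.act_mem_domain s a x x.2⟩ - T.act (-s) (T.σ a) (T.DPart s x) :=
  bddClosure_apply (T.twistedComm s a) (T.dense_domain s) (T.twistedComm_bounded s a) x

variable {Dinv : H →L[ℂ] H} (hD : IsBoundedInverse T.D Dinv)

/-- The component `D_±⁻¹ : H_∓ → H_±` of `D⁻¹`. -/
def invPart (s : ℤˣ) : T.half (-s) →L[ℂ] T.half s :=
  Dinv.restrict fun y hy => by
    obtain ⟨h, hy'⟩ := hD.1 y
    have h1 := hD.2 ⟨T.γ (Dinv y), T.γ_mem_domain _ h⟩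
    rw [T.anticomm ⟨Dinv y, h⟩, hy', T.mem_half.1 hy] at h1
    rw [mem_half]
    have h2 : Dinv (-(((-s : ℤˣ) : ℤ) : ℂ) • y) = T.γ (Dinv y) := by
      rw [neg_smul]; exact h1
    rw [← h2, map_smul]
    simp

theorem isBoundedInverse_invPart (s : ℤˣ) : IsBoundedInverse (T.DPart s) (T.invPart hD s) := by
  refine ⟨fun y => ?_, fun x => ?_⟩
  · obtain ⟨h, hy⟩ := hD.1 y
    exact ⟨h, Subtype.ext hy⟩
  · exact Subtype.ext (hD.2 ⟨((x : T.half s) : H), x.2⟩)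

/-- The operator `D_±⁻¹ σ(a_∓) D_±` on the domain of `D_±`. -/
def conjPart (s : ℤˣ) (a : A) : T.half s →ₗ.[ℂ] T.half s where
  domain := (T.DPart s).domain
  toFun := (T.invPart hD s : T.half (-s) →ₗ[ℂ] T.half s) ∘ₗ
    (T.act (-s) (T.σ a) : T.half (-s) →ₗ[ℂ] T.half (-s)) ∘ₗ (T.DPart s).toFun

/-- The bounded closure of `D_±⁻¹ σ(a_∓) D_±`. -/
def twistedAct (s : ℤˣ) (a : A) : T.half s →L[ℂ] T.half s :=
  bddClosure (T.conjPart hD s a)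

theorem conjPart_bounded (s : ℤˣ) (a : A) :
    ∃ C : ℝ, ∀ x : (T.conjPart hD s a).domain,
      ‖T.conjPart hD s a x‖ ≤ C * ‖(x : T.half s)‖ := by
  refine ⟨‖T.act s a - T.invPart hD s ∘L T.dσ s a‖, fun x => ?_⟩
  have h : T.conjPart hD s a x = (T.act s a - T.invPart hD s ∘L T.dσ s a) (x : T.half s) := by
    have h1 := T.dσ_apply s a x
    have h2 := (T.isBoundedInverse_invPart hD s).2
      ⟨T.act s a x, T.act_mem_domain s a x x.2⟩
    simp only [sub_apply, ContinuousLinearMap.comp_apply, h1, map_sub, h2]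
    rw [sub_sub_cancel]
    rfl
  rw [h]
  exact ContinuousLinearMap.le_opNorm _ _

theorem twistedAct_apply (s : ℤˣ) (a : A) (x : (T.DPart s).domain) :
    T.twistedAct hD s a (x : T.half s) =
      T.invPart hD s (T.act (-s) (T.σ a) (T.DPart s x)) :=
  bddClosure_apply (T.conjPart hD s a) (T.dense_domain s) (T.conjPart_bounded hD s a) x

/-! ### The half-character cocycles -/

/-- The operator
`D_±⁻¹ (D_± a⁰_± - σ(a⁰_∓) D_±) ⋯ D_±⁻¹ (D_± aⁿ_± - σ(aⁿ_∓) D_±)` on `H_±`. -/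
def characterOp (s : ℤˣ) {n : ℕ} (a : Fin (n + 1) → A) : T.half s →L[ℂ] T.half s :=
  (List.ofFn fun k => T.invPart hD s ∘L T.dσ s (a k)).prod

/-- The half-character `Φ^±_{D,σ}(a⁰, …, aⁿ)`. -/
def halfCharacter (s : ℤˣ) {n : ℕ} (a : Fin (n + 1) → A) : ℂ :=
  trace (T.characterOp hD s a)

/-- The extension of `Φ^±_{D,σ}` to matrices over `A`,
`Φ(E⁰, …, Eⁿ) = ∑ Φ(E⁰_{i₀ i₁}, E¹_{i₁ i₂}, …, Eⁿ_{iₙ i₀})`, the sum being over all `i₀, …, iₙ`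
(the index `k + 1` is cyclic in `Fin (n + 1)`). -/
def matrixHalfCharacter (s : ℤˣ) {n N : ℕ} (E : Fin (n + 1) → Matrix (Fin N) (Fin N) A) : ℂ :=
  ∑ i : Fin (n + 1) → Fin N, T.halfCharacter hD s fun k => E k (i k) (i (k + 1))

/-! ### The index maps -/

/-- The operator `e_±` on `H_± ⊗ ℂ^N`, for `e ∈ M_N(A)`. -/
def matAct (s : ℤˣ) {N : ℕ} (e : Matrix (Fin N) (Fin N) A) :
    PiLp 2 (fun _ : Fin N => T.half s) →L[ℂ] PiLp 2 (fun _ : Fin N => T.half s) :=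
  matOp (e.map (T.act s))

/-- The operator `f_±` on `H_± ⊗ ℂ^N`, the bounded closure of `D_±⁻¹ σ(e_∓) D_±`. -/
def matTwistedAct (s : ℤˣ) {N : ℕ} (e : Matrix (Fin N) (Fin N) A) :
    PiLp 2 (fun _ : Fin N => T.half s) →L[ℂ] PiLp 2 (fun _ : Fin N => T.half s) :=
  matOp (e.map (T.twistedAct hD s))

/-- The operator `f_± e_± : e_± (H_± ⊗ ℂ^N) → f_± (H_± ⊗ ℂ^N)`. -/
def indexOp (s : ℤˣ) {N : ℕ} (e : Matrix (Fin N) (Fin N) A) :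
    (T.matAct s e).range →L[ℂ] (T.matTwistedAct hD s e).range :=
  (T.matTwistedAct hD s e ∘L T.matAct s e).restrict fun x _ => ⟨T.matAct s e x, rfl⟩

/-- `Index^±_{D,σ}[e]`, the index `dim Ker - dim Coker` of `f_± e_±`. -/
def index (s : ℤˣ) {N : ℕ} (e : Matrix (Fin N) (Fin N) A) : ℤ :=
  (T.indexOp hD s e : (T.matAct s e).range →ₗ[ℂ] (T.matTwistedAct hD s e).range).index

end GradedSigmaTriple

end SigmaTriple

end

/-! Write E and F for the idempotents e_± and f_±. Since D⁻¹(Da - σ(a)D) = a - D⁻¹σ(a)D, the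
difference K = E - F is the matrix with entries D_±⁻¹(D_± e_ij - σ(e_ij) D_±). Each entry has
approximation numbers O(k^(-1/n)). Exponents add under products, so K^(n+1) has exponent (n+1)/n > 1
and is nuclear. The trace of K^(n+1), expanded over closed paths of matrix indices, is the
half-character at (e, …, e).

It remains to show that FE : ran E → ran F is Fredholm of index Tr K^(2k+1), where n = 2k. As K²
commutes with E and F, and EFE = (1 - K²)E, FEF = (1 - K²)F, the geometric sum V = ∑_{j ≤ k} K^(2j)
supplies a parametrix EV whose remainders are the restrictions of K^(2k+2). Calderón's formula
(`index_eq_trace_sub_trace`) gives index Tr K^(2k+2)E - Tr K^(2k+2)F = Tr K^(2k+3). Finally S = 1 -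
E - F anticommutes with K and S² = 1 - K², so Tr K^(2k+1)S² vanishes and Tr K^(2k+3) = Tr K^(2k+1)
(`index_idempotents`).

For the second claim, e* = σ(e) makes the adjoint of K on one half equal to -dL, where Ld is K on
the other half, L being D⁻¹ and d the twisted commutator of e. Cyclicity of the trace and the odd
power make the two traces negative conjugates of each other; being integers, they are opposite.

The trace is handled through nuclear representations T = ∑ ⟨y_i, ·⟩ x_i with square summable
families, for which Tr T = ∑ ⟨y_i, x_i⟩ is independent of the basis and cyclic. -/

namespace SigmaTriple

/-! ### Nuclear operators on Hilbert spaces and their trace. -/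

section Nuclear

set_option linter.unusedSectionVars false

variable {E F G : Type*}
  [NormedAddCommGroup E] [InnerProductSpace ℂ E] [CompleteSpace E]
  [NormedAddCommGroup F] [InnerProductSpace ℂ F] [CompleteSpace F]
  [NormedAddCommGroup G] [InnerProductSpace ℂ G] [CompleteSpace G]

theorem norm_inner_smul_le (x : F) (y z : E) :
    ‖inner ℂ y z • x‖ ≤ (‖x‖ ^ 2 + ‖y‖ ^ 2) * ‖z‖ := by
  rw [norm_smul]
  have h1 : ‖inner ℂ y z‖ ≤ ‖y‖ * ‖z‖ := norm_inner_le_norm y z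
  have h2 : ‖y‖ * ‖x‖ ≤ ‖x‖ ^ 2 + ‖y‖ ^ 2 := by
    nlinarith [sq_nonneg (‖x‖ - ‖y‖), sq_nonneg ‖x‖, sq_nonneg ‖y‖]
  calc ‖inner ℂ y z‖ * ‖x‖ ≤ ‖y‖ * ‖z‖ * ‖x‖ := by gcongr
    _ = ‖y‖ * ‖x‖ * ‖z‖ := by ring
    _ ≤ _ := by gcongr

/-- `x` and `y` are square summable families of vectors with `T = ∑ ⟨y i, ·⟩ x i`. -/
structure IsNuclearRep {ι : Type} (T : E →L[ℂ] F) (x : ι → F) (y : ι → E) : Prop where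
  left : Summable fun i => ‖x i‖ ^ 2
  right : Summable fun i => ‖y i‖ ^ 2
  hasSum : ∀ z, HasSum (fun i => inner ℂ (y i) z • x i) (T z)

/-- Nuclear operators between Hilbert spaces. -/
def IsNuclear (T : E →L[ℂ] F) : Prop :=
  ∃ (ι : Type) (x : ι → F) (y : ι → E), IsNuclearRep T x y

section Rep

variable {ι : Type} {T : E →L[ℂ] F} {x : ι → F} {y : ι → E}

theorem summable_sq_clm (B : F →L[ℂ] G) (hx : Summable fun i => ‖x i‖ ^ 2) :
    Summable fun i => ‖B (x i)‖ ^ 2 := by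
  refine Summable.of_nonneg_of_le (fun i => sq_nonneg _) (fun i => ?_) (hx.mul_left (‖B‖ ^ 2))
  rw [← mul_pow]
  gcongr
  exact B.le_opNorm _

theorem IsNuclearRep.clm_comp (h : IsNuclearRep T x y) (B : F →L[ℂ] G) :
    IsNuclearRep (B ∘L T) (fun i => B (x i)) y :=
  ⟨summable_sq_clm B h.left, h.right, fun z => by simpa using (h.hasSum z).mapL B⟩

theorem IsNuclearRep.comp_clm (h : IsNuclearRep T x y) (B : G →L[ℂ] E) :
    IsNuclearRep (T ∘L B) x (fun i => B.adjoint (y i)) :=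
  ⟨h.left, summable_sq_clm _ h.right, fun z => by
    simpa [ContinuousLinearMap.adjoint_inner_left] using h.hasSum (B z)⟩

/-- Parseval makes ∑_b |⟨b, x_i⟩|² equal to ‖x_i‖², and likewise for y_i. With |uv| ≤ |u|² + |v|²,
the double family is absolutely summable, which justifies the exchange of sums in
`IsNuclearRep.trace_eq`. -/
theorem summable_basis {S : E →L[ℂ] E} {x y : ι → E} (h : IsNuclearRep S x y) :
    Summable fun p : basisIndex E × ι =>
      inner ℂ (y p.2) (hilbertBasis E p.1) * inner ℂ (hilbertBasis E p.1) (x p.2) := by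
  set b := hilbertBasis E
  have key : ∀ v : E, HasSum (fun i => ‖inner ℂ (b i) v‖ ^ 2) (‖v‖ ^ 2) := by
    intro v
    have h1 := b.hasSum_inner_mul_inner v v
    have h2 := Complex.hasSum_re h1
    convert h2 using 1
    · funext i
      rw [← inner_conj_symm v (b i), ← Complex.normSq_eq_conj_mul_self, Complex.ofReal_re,
        Complex.normSq_eq_norm_sq]
    · rw [inner_self_eq_norm_sq_to_K]
      norm_cast
  have h3 : Summable fun p : ι × basisIndex E =>
      ‖inner ℂ (b p.2) (x p.1)‖ ^ 2 + ‖inner ℂ (b p.2) (y p.1)‖ ^ 2 := by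
    rw [summable_prod_of_nonneg (fun p => by positivity)]
    refine ⟨fun i => ((key (x i)).add (key (y i))).summable, ?_⟩
    simp only [fun i => ((key (x i)).add (key (y i))).tsum_eq]
    exact h.left.add h.right
  have h4 := (Equiv.prodComm (basisIndex E) ι).summable_iff.2 h3
  refine Summable.of_norm_bounded h4 (fun p => ?_)
  rw [norm_mul, norm_inner_symm (y p.2)]
  simp only [Function.comp, Equiv.prodComm_apply, Prod.fst_swap, Prod.snd_swap]
  nlinarith [sq_nonneg (‖inner ℂ (b p.1) (x p.2)‖ - ‖inner ℂ (b p.1) (y p.2)‖),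
    sq_nonneg ‖inner ℂ (b p.1) (x p.2)‖, sq_nonneg ‖inner ℂ (b p.1) (y p.2)‖]

theorem hasSum_basis {S : E →L[ℂ] E} {x y : ι → E} (h : IsNuclearRep S x y) (v : E) :
    HasSum (fun i => inner ℂ (y i) v * inner ℂ v (x i)) (inner ℂ v (S v)) := by
  simpa [inner_smul_right] using (h.hasSum v).mapL (innerSL ℂ v)

theorem IsNuclearRep.trace_eq {S : E →L[ℂ] E} {x y : ι → E} (h : IsNuclearRep S x y) :
    trace S = ∑' i, inner ℂ (y i) (x i) := by
  have hs := summable_basis h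
  unfold trace
  calc _ = ∑' b, ∑' i, inner ℂ (y i) (hilbertBasis E b) * inner ℂ (hilbertBasis E b) (x i) :=
        tsum_congr fun b => (hasSum_basis h _).tsum_eq.symm
    _ = ∑' i, ∑' b, inner ℂ (y i) (hilbertBasis E b) * inner ℂ (hilbertBasis E b) (x i) :=
        Summable.tsum_comm hs.prod_symm
    _ = _ := tsum_congr fun i => (hilbertBasis E).tsum_inner_mul_inner _ _

theorem IsNuclear.summable_trace {S : E →L[ℂ] E} (h : IsNuclear S) :
    Summable fun i => inner ℂ (hilbertBasis E i) (S (hilbertBasis E i)) := by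
  obtain ⟨ι, x, y, h⟩ := h
  exact (summable_basis h).prod.congr fun b => (hasSum_basis h (hilbertBasis E b)).tsum_eq

end Rep

theorem IsNuclear.clm_comp {T : E →L[ℂ] F} (h : IsNuclear T) (B : F →L[ℂ] G) :
    IsNuclear (B ∘L T) := by
  obtain ⟨ι, x, y, h⟩ := h
  exact ⟨ι, _, _, h.clm_comp B⟩

theorem IsNuclear.comp_clm {T : E →L[ℂ] F} (h : IsNuclear T) (B : G →L[ℂ] E) :
    IsNuclear (T ∘L B) := by
  obtain ⟨ι, x, y, h⟩ := h
  exact ⟨ι, _, _, h.comp_clm B⟩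

theorem IsNuclear.neg {T : E →L[ℂ] F} (h : IsNuclear T) : IsNuclear (-T) := by
  have := h.clm_comp (-ContinuousLinearMap.id ℂ F)
  convert this using 1
  ext; simp

theorem isNuclear_zero : IsNuclear (0 : E →L[ℂ] F) :=
  ⟨Empty, Empty.elim, Empty.elim, summable_empty, summable_empty, fun z => by simp [hasSum_empty]⟩

theorem IsNuclear.add {S T : E →L[ℂ] F} (hS : IsNuclear S) (hT : IsNuclear T) :
    IsNuclear (S + T) := by
  obtain ⟨ι, x, y, h⟩ := hS
  obtain ⟨κ, x', y', h'⟩ := hT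
  exact ⟨ι ⊕ κ, Sum.elim x x', Sum.elim y y',
    (HasSum.sum (f := fun i => ‖Sum.elim x x' i‖ ^ 2) h.left.hasSum h'.left.hasSum).summable,
    (HasSum.sum (f := fun i => ‖Sum.elim y y' i‖ ^ 2) h.right.hasSum h'.right.hasSum).summable,
    fun z => HasSum.sum (f := fun i => inner ℂ (Sum.elim y y' i) z • Sum.elim x x' i)
      (h.hasSum z) (h'.hasSum z)⟩

theorem IsNuclear.sub {S T : E →L[ℂ] F} (hS : IsNuclear S) (hT : IsNuclear T) :
    IsNuclear (S - T) := by
  rw [sub_eq_add_neg]; exact hS.add hT.neg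

theorem isNuclear_sum {α : Type*} (s : Finset α) {T : α → E →L[ℂ] F}
    (h : ∀ a ∈ s, IsNuclear (T a)) : IsNuclear (∑ a ∈ s, T a) :=
  Finset.sum_induction _ IsNuclear (fun _ _ => IsNuclear.add) isNuclear_zero h

theorem trace_add {S T : E →L[ℂ] E} (hS : IsNuclear S) (hT : IsNuclear T) :
    trace (S + T) = trace S + trace T := by
  unfold trace
  rw [← hS.summable_trace.tsum_add hT.summable_trace]
  simp

theorem trace_neg (S : E →L[ℂ] E) : trace (-S) = -trace S := by
  unfold trace
  simp [inner_neg_right, tsum_neg]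

theorem trace_sub {S T : E →L[ℂ] E} (hS : IsNuclear S) (hT : IsNuclear T) :
    trace (S - T) = trace S - trace T := by
  rw [sub_eq_add_neg, trace_add hS hT.neg, trace_neg, sub_eq_add_neg]

theorem trace_zero : trace (0 : E →L[ℂ] E) = 0 := by simp [trace]

theorem trace_sum {α : Type*} (s : Finset α) {T : α → E →L[ℂ] E}
    (h : ∀ a ∈ s, IsNuclear (T a)) : trace (∑ a ∈ s, T a) = ∑ a ∈ s, trace (T a) := by
  classical
  induction s using Finset.induction_on with
  | empty => simp [trace_zero]
  | insert a s ha ih =>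
    have h' : ∀ a ∈ s, IsNuclear (T a) := fun b hb => h b (Finset.mem_insert_of_mem hb)
    rw [Finset.sum_insert ha, Finset.sum_insert ha,
      trace_add (h a (Finset.mem_insert_self _ _)) (isNuclear_sum s h'), ih h']

theorem trace_adjoint (S : E →L[ℂ] E) : trace S.adjoint = star (trace S) := by
  unfold trace
  rw [tsum_star]
  refine tsum_congr fun i => ?_
  rw [ContinuousLinearMap.adjoint_inner_right, ← inner_conj_symm]
  rfl

/-- A representation (x, y) of A yields (Bx, y) for BA and (x, B*y) for AB, and ⟨y_i, B x_i⟩ = ⟨B*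
y_i, x_i⟩ termwise. Only one factor has to be nuclear. -/
theorem trace_comp_comm {A : E →L[ℂ] F} (hA : IsNuclear A) (B : F →L[ℂ] E) :
    trace (A ∘L B) = trace (B ∘L A) := by
  obtain ⟨ι, x, y, h⟩ := hA
  rw [(h.clm_comp B).trace_eq, (h.comp_clm B).trace_eq]
  simp [ContinuousLinearMap.adjoint_inner_left]

/-- Expand T z in an orthonormal basis of the range. The free scale c shifts weight between the two
families; `isNuclear_of_hasSum` uses it to balance their square sums. -/
theorem exists_nuclearRep_of_finiteDimensional (T : E →L[ℂ] F)
    [FiniteDimensional ℂ (T : E →ₗ[ℂ] F).range] (c : ℝ) (hc : 0 < c) :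
    let e := stdOrthonormalBasis ℂ (T : E →ₗ[ℂ] F).range
    IsNuclearRep T (fun i => (c : ℂ) • (e i : F)) (fun i => (c⁻¹ : ℂ) • T.adjoint (e i)) := by
  intro e
  refine ⟨.of_finite, .of_finite, fun z => ?_⟩
  have h1 := e.sum_repr' ⟨T z, z, rfl⟩
  have h2 : T z = ∑ i, inner ℂ (e i : F) (T z) • (e i : F) := by
    conv_lhs => rw [show T z = ((⟨T z, z, rfl⟩ : (T : E →ₗ[ℂ] F).range) : F) from rfl, ← h1]
    push_cast
    rfl
  rw [h2]
  have h3 : (fun i => inner ℂ ((c⁻¹ : ℂ) • T.adjoint (e i)) z • (c : ℂ) • (e i : F)) =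
      fun i => inner ℂ (e i : F) (T z) • (e i : F) := by
    funext i
    rw [inner_smul_left, ContinuousLinearMap.adjoint_inner_left, smul_smul, mul_right_comm,
      map_inv₀, Complex.conj_ofReal, inv_mul_cancel₀ (by exact_mod_cast hc.ne'), one_mul]
  rw [h3]
  exact hasSum_fintype _

theorem isNuclear_of_finiteDimensional (T : E →L[ℂ] F)
    [FiniteDimensional ℂ (T : E →ₗ[ℂ] F).range] : IsNuclear T :=
  ⟨_, _, _, exists_nuclearRep_of_finiteDimensional T 1 one_pos⟩

theorem trace_of_idempotent (P : E →L[ℂ] E) (hP : ∀ x, P (P x) = P x)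
    [FiniteDimensional ℂ (P : E →ₗ[ℂ] E).range] :
    trace P = Module.finrank ℂ (P : E →ₗ[ℂ] E).range := by
  rw [(exists_nuclearRep_of_finiteDimensional P 1 one_pos).trace_eq]
  set e := stdOrthonormalBasis ℂ (P : E →ₗ[ℂ] E).range
  have h : ∀ i, inner ℂ (((1 : ℝ) : ℂ)⁻¹ • P.adjoint (e i)) (((1 : ℝ) : ℂ) • (e i : E)) = 1 := by
    intro i
    have h1 : P (e i : E) = e i := by
      obtain ⟨z, hz⟩ := (e i).2
      rw [← hz]; exact hP z
    have h2 := e.orthonormal.1 i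
    simp only [Complex.ofReal_one, inv_one, one_smul, ContinuousLinearMap.adjoint_inner_left, h1]
    rw [inner_self_eq_norm_sq_to_K]
    rw [Submodule.coe_norm] at *
    simp [h2]
  simp_rw [h]
  simp

/-- Nuclear operators are norm limits of operators of finite rank. -/
theorem IsNuclear.exists_finiteRank_approx {T : E →L[ℂ] F} (h : IsNuclear T) {ε : ℝ} (hε : 0 < ε) :
    ∃ R : E →L[ℂ] F, (R : E →ₗ[ℂ] F).HasFiniteRange ∧ ‖T - R‖ ≤ ε := by
  obtain ⟨ι, x, y, h⟩ := h
  have hs := h.left.add h.right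
  -- Truncating the representation to a finite set s leaves an error bounded by the tail of ∑
  -- (‖x_i‖² + ‖y_i‖²).
  obtain ⟨s, hs'⟩ := (tendsto_order.1 (tendsto_tsum_compl_atTop_zero
    (fun i => ‖x i‖ ^ 2 + ‖y i‖ ^ 2))).2 ε hε |>.exists
  refine ⟨∑ i ∈ s, (innerSL ℂ (y i)).smulRight (x i), ?_, ?_⟩
  · rw [ContinuousLinearMap.toLinearMap_sum]
    refine Finset.sum_induction _ LinearMap.HasFiniteRange (fun _ _ => LinearMap.HasFiniteRange.add)
      LinearMap.HasFiniteRange.zero fun i _ => ?_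
    rw [LinearMap.HasFiniteRange]
    refine Submodule.FG.of_le (T := Submodule.span ℂ {x i}) (Submodule.fg_span_singleton _) ?_
    rintro _ ⟨z, rfl⟩
    exact Submodule.mem_span_singleton.2 ⟨_, rfl⟩
  · refine ContinuousLinearMap.opNorm_le_bound _ hε.le fun z => ?_
    have h1 : HasSum (fun i : {i // i ∉ s} => inner ℂ (y i) z • x i)
        ((T - ∑ i ∈ s, (innerSL ℂ (y i)).smulRight (x i)) z) := by
      have := (s.hasSum_compl_iff (f := fun i => inner ℂ (y i) z • x i)
        (a := ((T - ∑ i ∈ s, (innerSL ℂ (y i)).smulRight (x i)) z))).2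
      apply this
      convert h.hasSum z using 1
      simp [sum_apply]
    have h2 : Summable fun i : {i // i ∉ s} => (‖x i‖ ^ 2 + ‖y i‖ ^ 2) * ‖z‖ :=
      (hs.subtype _).mul_right _
    calc _ ≤ ∑' i : {i // i ∉ s}, (‖x i‖ ^ 2 + ‖y i‖ ^ 2) * ‖z‖ :=
          h1.norm_le_of_bounded h2.hasSum fun i => norm_inner_smul_le _ _ _
      _ = (∑' i : {i // i ∉ s}, (‖x i‖ ^ 2 + ‖y i‖ ^ 2)) * ‖z‖ := tsum_mul_right
      _ ≤ ε * ‖z‖ := by gcongr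

end Nuclear

end SigmaTriple

/-! ### Characteristic values, rank decay, and nuclearity from decay. -/

namespace SigmaTriple

section Decay

variable {E F G : Type*}
  [NormedAddCommGroup E] [NormedSpace ℂ E] [NormedAddCommGroup F] [NormedSpace ℂ F]
  [NormedAddCommGroup G] [NormedSpace ℂ G]

theorem charValue_le {T R : E →L[ℂ] F} {k : ℕ} (hR : (R : E →ₗ[ℂ] F).rank ≤ (k : Cardinal)) :
    charValue T k ≤ ‖T - R‖ :=
  csInf_le ⟨0, by rintro _ ⟨R, -, rfl⟩; exact norm_nonneg _⟩ ⟨R, hR, rfl⟩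

theorem charValue_nonneg (T : E →L[ℂ] F) (k : ℕ) : 0 ≤ charValue T k :=
  Real.sInf_nonneg (by rintro _ ⟨R, -, rfl⟩; exact norm_nonneg _)

theorem exists_norm_sub_lt_of_charValue_lt {T : E →L[ℂ] F} {k : ℕ} {r : ℝ} (h : charValue T k < r) :
    ∃ R : E →L[ℂ] F, (R : E →ₗ[ℂ] F).rank ≤ (k : Cardinal) ∧ ‖T - R‖ < r := by
  obtain ⟨_, ⟨R, hR, rfl⟩, hr⟩ := exists_lt_of_csInf_lt
    (⟨‖T - 0‖, 0, by simp, rfl⟩ :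
      {r : ℝ | ∃ R : E →L[ℂ] F, (R : E →ₗ[ℂ] F).rank ≤ (k : Cardinal) ∧ r = ‖T - R‖}.Nonempty) h
  exact ⟨R, hR, hr⟩

/-- `T` is approximated by operators of rank at most `k` up to `O((k + 1) ^ (-p))`. -/
def HasRankDecay (p : ℝ) (T : E →L[ℂ] F) : Prop :=
  ∃ C : ℝ, 0 ≤ C ∧ ∀ k : ℕ, ∃ R : E →L[ℂ] F, (R : E →ₗ[ℂ] F).rank ≤ (k : Cardinal) ∧
    ‖T - R‖ ≤ C * ((k : ℝ) + 1) ^ (-p)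

theorem hasRankDecay_of_charValue_le {p C : ℝ} {T : E →L[ℂ] F}
    (h : ∀ k : ℕ, charValue T k ≤ C * ((k : ℝ) + 1) ^ (-p)) : HasRankDecay p T := by
  have hC : 0 ≤ C := by
    have := (charValue_nonneg T 0).trans (h 0)
    simpa using this
  -- The infimum defining the characteristic value need not be attained; the extra 1 gives the room
  -- to choose an actual approximant.
  refine ⟨C + 1, by positivity, fun k => ?_⟩
  have hk : (0 : ℝ) < ((k : ℝ) + 1) ^ (-p) := by positivity
  obtain ⟨R, hR, hr⟩ := exists_norm_sub_lt_of_charValue_lt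
    ((h k).trans_lt (show _ < (C + 1) * ((k : ℝ) + 1) ^ (-p) by linarith))
  exact ⟨R, hR, hr.le⟩

theorem HasRankDecay.charValue_le {p : ℝ} {T : E →L[ℂ] F} (h : HasRankDecay p T) :
    ∃ C : ℝ, ∀ k : ℕ, charValue T k ≤ C * ((k : ℝ) + 1) ^ (-p) := by
  obtain ⟨C, -, h⟩ := h
  refine ⟨C, fun k => ?_⟩
  obtain ⟨R, hR, hr⟩ := h k
  exact (_root_.SigmaTriple.charValue_le hR).trans hr

theorem HasRankDecay.summable_charValue {p : ℝ} (hp : 1 < p) {T : E →L[ℂ] F}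
    (h : HasRankDecay p T) : Summable (charValue T) := by
  obtain ⟨C, hC⟩ := h.charValue_le
  refine Summable.of_nonneg_of_le (charValue_nonneg T) hC (Summable.mul_left _ ?_)
  have h1 : Summable fun k : ℕ => (k : ℝ) ^ (-p) := Real.summable_nat_rpow.2 (by linarith)
  simpa using (summable_nat_add_iff 1).2 h1

theorem range_sub_le_sup (S T : E →ₗ[ℂ] F) : (S - T).range ≤ S.range ⊔ T.range := by
  rintro _ ⟨z, rfl⟩
  exact Submodule.sub_mem _ (Submodule.mem_sup_left ⟨z, rfl⟩) (Submodule.mem_sup_right ⟨z, rfl⟩)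

theorem rank_clm_comp_le (B : F →ₗ[ℂ] G) {R : E →ₗ[ℂ] F} {k : ℕ} (hR : R.rank ≤ (k : Cardinal)) :
    (B ∘ₗ R).rank ≤ (k : Cardinal) := by
  have h := LinearMap.lift_rank_comp_le_right R B
  have h2 := h.trans (Cardinal.lift_le.2 hR)
  simpa using h2

theorem rank_comp_clm_le {R : F →ₗ[ℂ] G} (B : E →ₗ[ℂ] F) {k : ℕ} (hR : R.rank ≤ (k : Cardinal)) :
    (R ∘ₗ B).rank ≤ (k : Cardinal) :=
  (LinearMap.rank_comp_le_left B R).trans hR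

theorem HasRankDecay.clm_comp {p : ℝ} {T : E →L[ℂ] F} (h : HasRankDecay p T) (B : F →L[ℂ] G) :
    HasRankDecay p (B ∘L T) := by
  obtain ⟨C, hC, h⟩ := h
  refine ⟨‖B‖ * C, by positivity, fun k => ?_⟩
  obtain ⟨R, hR, hr⟩ := h k
  refine ⟨B ∘L R, rank_clm_comp_le (B : F →ₗ[ℂ] G) hR, ?_⟩
  rw [← ContinuousLinearMap.comp_sub, mul_assoc]
  exact (B.opNorm_comp_le _).trans (by gcongr)

theorem HasRankDecay.comp_clm {p : ℝ} {T : F →L[ℂ] G} (h : HasRankDecay p T) (B : E →L[ℂ] F) :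
    HasRankDecay p (T ∘L B) := by
  obtain ⟨C, hC, h⟩ := h
  refine ⟨C * ‖B‖, by positivity, fun k => ?_⟩
  obtain ⟨R, hR, hr⟩ := h k
  refine ⟨R ∘L B, rank_comp_clm_le (B : E →ₗ[ℂ] F) hR, ?_⟩
  rw [← ContinuousLinearMap.sub_comp, mul_right_comm]
  exact (ContinuousLinearMap.opNorm_comp_le _ _).trans (by gcongr)

/-- This is the multiplicativity of approximation numbers: (S - R)(T - R') differs from ST by R(T -
R') + SR', whose rank is at most rank R + rank R'. -/
theorem HasRankDecay.comp {p q : ℝ} (hp : 0 ≤ p) (hq : 0 ≤ q) {S : F →L[ℂ] G} {T : E →L[ℂ] F}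
    (hS : HasRankDecay p S) (hT : HasRankDecay q T) : HasRankDecay (p + q) (S ∘L T) := by
  obtain ⟨C, hC, hS⟩ := hS
  obtain ⟨C', hC', hT⟩ := hT
  refine ⟨C * C' * 2 ^ (p + q), by positivity, fun m => ?_⟩
  -- The rank budget m is split evenly between the factors; since m/2 + 1 ≥ (m + 1)/2 even after
  -- rounding down, this costs the factor 2^(p+q).
  obtain ⟨R, hR, hr⟩ := hS (m / 2)
  obtain ⟨R', hR', hr'⟩ := hT (m / 2)
  refine ⟨R ∘L (T - R') + S ∘L R', ?_, ?_⟩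
  · have h1 := LinearMap.rank_add_le ((R : F →ₗ[ℂ] G) ∘ₗ ((T - R' : E →L[ℂ] F) : E →ₗ[ℂ] F))
      ((S : F →ₗ[ℂ] G) ∘ₗ (R' : E →ₗ[ℂ] F))
    refine h1.trans ((add_le_add (rank_comp_clm_le _ hR) (rank_clm_comp_le _ hR')).trans ?_)
    exact_mod_cast (by omega : m / 2 + m / 2 ≤ m)
  · have h1 : S ∘L T - (R ∘L (T - R') + S ∘L R') = (S - R) ∘L (T - R') := by
      ext z; simp; abel
    have h2 : ((m : ℝ) + 1) / 2 ≤ ((m / 2 : ℕ) : ℝ) + 1 := by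
      have : m + 1 ≤ 2 * (m / 2 + 1) := by omega
      have : ((m + 1 : ℕ) : ℝ) ≤ ((2 * (m / 2 + 1) : ℕ) : ℝ) := by exact_mod_cast this
      push_cast at this
      linarith
    have h3 : (((m / 2 : ℕ) : ℝ) + 1) ^ (-(p + q)) ≤ 2 ^ (p + q) * ((m : ℝ) + 1) ^ (-(p + q)) := by
      refine (Real.rpow_le_rpow_of_nonpos (by positivity) h2 (by linarith)).trans (le_of_eq ?_)
      rw [Real.div_rpow (by positivity) (by positivity), Real.rpow_neg (by norm_num : (0:ℝ) ≤ 2),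
        div_inv_eq_mul, mul_comm]
    rw [h1]
    calc _ ≤ ‖S - R‖ * ‖T - R'‖ := ContinuousLinearMap.opNorm_comp_le _ _
      _ ≤ (C * (((m / 2 : ℕ) : ℝ) + 1) ^ (-p)) * (C' * (((m / 2 : ℕ) : ℝ) + 1) ^ (-q)) := by gcongr
      _ = C * C' * (((m / 2 : ℕ) : ℝ) + 1) ^ (-(p + q)) := by
        rw [neg_add, Real.rpow_add (by positivity)]; ring
      _ ≤ C * C' * (2 ^ (p + q) * ((m : ℝ) + 1) ^ (-(p + q))) := by gcongr
      _ = _ := by ring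

theorem hasRankDecay_list_prod {p : ℝ} (hp : 0 ≤ p) (l : List (E →L[ℂ] E)) (hl : l ≠ [])
    (h : ∀ T ∈ l, HasRankDecay p T) : HasRankDecay (l.length * p) l.prod := by
  induction l with
  | nil => exact absurd rfl hl
  | cons T l ih =>
    rcases eq_or_ne l [] with rfl | hl'
    · simpa using h T (by simp)
    · have h1 : HasRankDecay _ (T * l.prod) := (h T (by simp)).comp hp (by positivity)
        (ih hl' fun S hS => h S (List.mem_cons_of_mem _ hS))
      rw [List.prod_cons, List.length_cons]
      convert h1 using 1
      push_cast; ring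

end Decay

section DecayNuclear

variable {E F : Type*}
  [NormedAddCommGroup E] [InnerProductSpace ℂ E] [CompleteSpace E]
  [NormedAddCommGroup F] [InnerProductSpace ℂ F] [CompleteSpace F]

/-- A block D_j splits into finrank-many rank-one terms. With scale √(q j), both vectors of each
term have squared norm O(q j), so the blocks together contribute O(∑ r j * q j). -/
theorem isNuclear_of_hasSum {T : E →L[ℂ] F} (D : ℕ → E →L[ℂ] F) {r q : ℕ → ℝ} {C : ℝ}
    (hfin : ∀ j, FiniteDimensional ℂ (D j : E →ₗ[ℂ] F).range)
    (hr : ∀ j, (Module.finrank ℂ (D j : E →ₗ[ℂ] F).range : ℝ) ≤ r j)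
    (hq : ∀ j, 0 < q j) (hD : ∀ j, ‖D j‖ ≤ C * q j) (hs : Summable fun j => r j * q j)
    (hT : ∀ z, HasSum (fun j => D j z) (T z)) : IsNuclear T := by
  have hsq : ∀ j, 0 < √(q j) := fun j => Real.sqrt_pos.2 (hq j)
  have hrep := fun j => exists_nuclearRep_of_finiteDimensional (D j) (√(q j)) (hsq j)
  let e := fun j => stdOrthonormalBasis ℂ (D j : E →ₗ[ℂ] F).range
  let x : (Σ j, Fin (Module.finrank ℂ (D j : E →ₗ[ℂ] F).range)) → F :=
    fun p => ((√(q p.1) : ℝ) : ℂ) • (e p.1 p.2 : F)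
  let y : (Σ j, Fin (Module.finrank ℂ (D j : E →ₗ[ℂ] F).range)) → E :=
    fun p => ((√(q p.1) : ℝ) : ℂ)⁻¹ • (D p.1).adjoint (e p.1 p.2)
  have he : ∀ j i, ‖(e j i : F)‖ = 1 := fun j i => (e j).orthonormal.1 i
  have hx : ∀ p, ‖x p‖ ^ 2 = q p.1 := by
    intro p
    simp only [x, norm_smul, he, mul_one, Complex.norm_real, Real.norm_eq_abs, sq_abs]
    exact Real.sq_sqrt (hq _).le
  have hy : ∀ p, ‖y p‖ ^ 2 ≤ C ^ 2 * q p.1 := by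
    intro p
    have h1 : ‖(D p.1).adjoint (e p.1 p.2 : F)‖ ≤ C * q p.1 := by
      refine ((D p.1).adjoint.le_opNorm _).trans ?_
      rw [he, mul_one, LinearIsometryEquiv.norm_map]
      exact hD _
    have h2 : ‖y p‖ ^ 2 = ‖(D p.1).adjoint (e p.1 p.2 : F)‖ ^ 2 / q p.1 := by
      simp only [y, norm_smul, norm_inv, Complex.norm_real, Real.norm_eq_abs, mul_pow, inv_pow,
        sq_abs]
      rw [Real.sq_sqrt (hq _).le, div_eq_inv_mul]
    rw [h2, div_le_iff₀ (hq _)]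
    calc _ ≤ (C * q p.1) ^ 2 := by gcongr
      _ = _ := by ring
  have hsum : Summable fun p : (Σ j, Fin (Module.finrank ℂ (D j : E →ₗ[ℂ] F).range)) => q p.1 := by
    rw [summable_sigma_of_nonneg fun p => (hq _).le]
    refine ⟨fun j => .of_finite, ?_⟩
    refine Summable.of_nonneg_of_le (fun j => tsum_nonneg fun _ => (hq _).le) (fun j => ?_) hs
    simp only [tsum_fintype, Finset.sum_const, Finset.card_univ, Fintype.card_fin, nsmul_eq_mul]
    exact mul_le_mul_of_nonneg_right (hr j) (hq j).le
  have hl : Summable fun p => ‖x p‖ ^ 2 := by simpa only [hx] using hsum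
  have hr : Summable fun p => ‖y p‖ ^ 2 :=
    Summable.of_nonneg_of_le (fun _ => sq_nonneg _) hy (hsum.mul_left _)
  refine ⟨_, x, y, hl, hr, fun z => ?_⟩
  refine HasSum.sigma_of_hasSum (hT z) (fun j => (hrep j).hasSum z) ?_
  exact Summable.of_norm_bounded ((hl.add hr).mul_right ‖z‖) fun p => norm_inner_smul_le _ _ _

/-- Telescope along approximants R_j of rank at most 2^j: the differences have rank O(2^j) and norm
O(2^(-pj)), and ∑ 2^j 2^(-pj) converges because p > 1. -/
theorem HasRankDecay.isNuclear {p : ℝ} (hp : 1 < p) {T : E →L[ℂ] F} (h : HasRankDecay p T) :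
    IsNuclear T := by
  obtain ⟨C, hC, h⟩ := h
  choose R hR hr using fun j : ℕ => h (2 ^ j)
  set q : ℝ := 2 ^ (-p) with hq
  have hq0 : 0 < q := by positivity
  have hq2 : 2 * q < 1 := by
    rw [hq, ← Real.rpow_one_add' (by norm_num) (by linarith)]
    exact Real.rpow_lt_one_of_one_lt_of_neg (by norm_num) (by linarith)
  have hqj : ∀ j, ‖T - R j‖ ≤ C * q ^ j := by
    intro j
    refine (hr j).trans ?_
    gcongr
    rw [hq, ← Real.rpow_natCast, ← Real.rpow_mul (by norm_num), mul_comm (-p),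
      Real.rpow_mul (by norm_num), Real.rpow_natCast]
    refine Real.rpow_le_rpow_of_nonpos (by positivity) ?_ (by linarith)
    push_cast; linarith
  have hfin : ∀ j, FiniteDimensional ℂ (R j : E →ₗ[ℂ] F).range := fun j =>
    Module.rank_lt_aleph0_iff.1 ((hR j).trans_lt (Cardinal.natCast_lt_aleph0))
  have hfin' : ∀ j, FiniteDimensional ℂ ((R (j + 1) - R j : E →L[ℂ] F) : E →ₗ[ℂ] F).range :=
    fun j => Submodule.finiteDimensional_of_le
      (range_sub_le_sup (R (j + 1) : E →ₗ[ℂ] F) (R j : E →ₗ[ℂ] F))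
  have hfr : ∀ j, Module.finrank ℂ (R j : E →ₗ[ℂ] F).range ≤ 2 ^ j := fun j =>
    Module.finrank_le_of_rank_le (hR j)
  have h0 : IsNuclear (T - R 0) := by
    refine isNuclear_of_hasSum (fun j => R (j + 1) - R j) (r := fun j => 4 * 2 ^ j)
      (q := fun j => q ^ j) (C := 2 * C) hfin' (fun j => ?_) (fun j => by positivity)
      (fun j => ?_) ?_ fun z => ?_
    · have h1 := (Submodule.finrank_mono (range_sub_le_sup (R (j + 1) : E →ₗ[ℂ] F)
        (R j : E →ₗ[ℂ] F))).trans (Submodule.finrank_add_le_finrank_add_finrank _ _)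
      have h2 : Module.finrank ℂ ((R (j + 1) - R j : E →L[ℂ] F) : E →ₗ[ℂ] F).range ≤ 4 * 2 ^ j := by
        have := hfr j
        have := hfr (j + 1)
        rw [pow_succ] at this
        exact h1.trans (by omega)
      exact_mod_cast h2
    · have h1 : R (j + 1) - R j = (T - R j) - (T - R (j + 1)) := by abel
      rw [h1]
      refine (norm_sub_le _ _).trans ?_
      have h2 : C * q ^ (j + 1) ≤ C * q ^ j := by
        have : q ≤ 1 := by linarith
        exact mul_le_mul_of_nonneg_left (pow_le_pow_of_le_one hq0.le this (Nat.le_succ j)) hC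
      linarith [hqj j, hqj (j + 1)]
    · have : (fun j : ℕ => (4 * 2 ^ j) * q ^ j) = fun j => 4 * (2 * q) ^ j := by
        funext j; rw [mul_pow]; ring
      rw [this]
      exact (summable_geometric_of_lt_one (by positivity) hq2).mul_left _
    · have hgeo : Summable fun j => C * q ^ j * ‖z‖ :=
        ((summable_geometric_of_lt_one hq0.le (by linarith)).mul_left C).mul_right _
      have hz : ∀ j, ‖(T - R j) z‖ ≤ C * q ^ j * ‖z‖ := fun j =>
        ((T - R j).le_opNorm z).trans (by gcongr; exact hqj j)
      -- The partial sums telescope to (T - R 0) z - (T - R n) z, so the remainder has to vanish in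
      -- the limit.
      have hlim : Filter.Tendsto (fun j => (T - R j) z) Filter.atTop (nhds 0) :=
        squeeze_zero_norm hz hgeo.tendsto_atTop_zero
      have hsum : Summable fun j => (R (j + 1) - R j) z := by
        refine Summable.of_norm_bounded (hgeo.add ((summable_nat_add_iff 1).2 hgeo)) fun j => ?_
        have : (R (j + 1) - R j) z = (T - R j) z - (T - R (j + 1)) z := by simp
        rw [this]
        exact (norm_sub_le _ _).trans (add_le_add (hz j) (hz (j + 1)))
      rw [hsum.hasSum_iff_tendsto_nat]
      have h3 : ∀ n, ∑ j ∈ Finset.range n, (R (j + 1) - R j) z = (T - R 0) z - (T - R n) z := by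
        intro n
        have := Finset.sum_range_sub (fun j => R j z) n
        simp only [sub_apply] at this ⊢
        rw [this]; abel
      simp only [h3]
      simpa using hlim.const_sub ((T - R 0) z)
  have := hfin 0
  simpa using h0.add (isNuclear_of_finiteDimensional (R 0))

end DecayNuclear

end SigmaTriple

/-! ### Fredholm operators and Calderón's index formula. -/

namespace SigmaTriple

section Calderon

variable {X Y : Type*}
  [NormedAddCommGroup X] [InnerProductSpace ℂ X] [CompleteSpace X]
  [NormedAddCommGroup Y] [InnerProductSpace ℂ Y] [CompleteSpace Y]

/-- An operator which is invertible modulo nuclear operators is Fredholm. -/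
theorem isFredholm_of_isNuclear {u : X →L[ℂ] Y} {v : Y →L[ℂ] X}
    (hvu : IsNuclear (ContinuousLinearMap.id ℂ X - v ∘L u))
    (huv : IsNuclear (ContinuousLinearMap.id ℂ Y - u ∘L v)) : u.IsFredholm := by
  -- Removing a finite rank part leaves remainders of norm at most 1/2, so vu + R and uv + R' become
  -- invertible by the Neumann series.
  obtain ⟨R, hR, hr⟩ := hvu.exists_finiteRank_approx (show (0 : ℝ) < 1 / 2 by norm_num)
  obtain ⟨R', hR', hr'⟩ := huv.exists_finiteRank_approx (show (0 : ℝ) < 1 / 2 by norm_num)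
  obtain ⟨a, ha⟩ := isUnit_one_sub_of_norm_lt_one (hr.trans_lt (by norm_num : (1 / 2 : ℝ) < 1))
  obtain ⟨b, hb⟩ := isUnit_one_sub_of_norm_lt_one (hr'.trans_lt (by norm_num : (1 / 2 : ℝ) < 1))
  have ha' : ∀ x, (a : X →L[ℂ] X) x = v (u x) + R x := fun x => by rw [ha]; simp; abel
  have hb' : ∀ y, (b : Y →L[ℂ] Y) y = u (v y) + R' y := fun x => by rw [hb]; simp; abel
  have ha1 : ∀ x, (↑a⁻¹ : X →L[ℂ] X) ((a : X →L[ℂ] X) x) = x := fun x =>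
    DFunLike.congr_fun a.inv_mul x
  have hb1 : ∀ y, (b : Y →L[ℂ] Y) ((↑b⁻¹ : Y →L[ℂ] Y) y) = y := fun x =>
    DFunLike.congr_fun b.mul_inv x
  set a' : X →L[ℂ] X := ↑a⁻¹
  set b' : Y →L[ℂ] Y := ↑b⁻¹
  have h1 : ∀ x, a' (v (u x)) = x - a' (R x) := fun x => by
    rw [eq_sub_iff_add_eq, ← map_add, ← ha', ha1]
  have h2 : ∀ y, u (v (b' y)) = y - R' (b' y) := fun y => by
    rw [eq_sub_iff_add_eq, ← hb', hb1]
  refine ContinuousLinearMap.IsFredholm.of_isQuasiInverse (v := a' ∘L v) ⟨?_, ?_⟩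
  · rw [LinearMap.IsLeftQuasiInverse, LinearMap.FiniteRangeSetoid.equiv_iff_hasFiniteRange]
    have : ((a' ∘L v : Y →L[ℂ] X) : Y →ₗ[ℂ] X) ∘ₗ (u : X →ₗ[ℂ] Y) - LinearMap.id =
        -((a' : X →ₗ[ℂ] X) ∘ₗ (R : X →ₗ[ℂ] X)) := by
      ext x; simp [h1]
    rw [this]
    exact (hR.comp_left _).neg
  · rw [LinearMap.IsRightQuasiInverse, LinearMap.FiniteRangeSetoid.equiv_iff_hasFiniteRange]
    have : (u : X →ₗ[ℂ] Y) ∘ₗ ((a' ∘L v : Y →L[ℂ] X) : Y →ₗ[ℂ] X) - LinearMap.id =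
        ((u ∘L a' ∘L v : Y →L[ℂ] Y) : Y →ₗ[ℂ] Y) ∘ₗ ((R' : Y →ₗ[ℂ] Y) ∘ₗ (b' : Y →ₗ[ℂ] Y)) -
        (u : X →ₗ[ℂ] Y) ∘ₗ ((a' : X →ₗ[ℂ] X) ∘ₗ ((R : X →ₗ[ℂ] X) ∘ₗ (v ∘L b' : Y →L[ℂ] X))) -
        (R' : Y →ₗ[ℂ] Y) ∘ₗ (b' : Y →ₗ[ℂ] Y) := by
      ext y
      have h3 := h1 (v (b' y))
      rw [h2, map_sub, map_sub, sub_eq_iff_eq_add] at h3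
      simp [h3, h2]
      abel
    rw [this]
    exact (((hR'.comp_right _).comp_left _).sub
      (((hR.comp_right _).comp_left _).comp_left _)).sub (hR'.comp_right _)

omit [CompleteSpace X] [CompleteSpace Y] in
-- A Fredholm operator restricts to an isomorphism from a complement of its kernel onto its range.
-- Inverting it and extending by zero on a complement of the range gives w, for which 1 - wu and 1 -
-- uw are exact idempotents.
theorem exists_generalizedInverse {u : X →L[ℂ] Y} (hu : u.IsFredholm) :
    ∃ w : Y →L[ℂ] X, (∀ x, u (w (u x)) = u x) ∧ ∀ y, w (u (w y)) = w y := by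
  obtain ⟨pkg⟩ := hu.nonempty_fredholmPackage
  have h := pkg.eq_equiv
  have h' : ∀ x, u x = pkg.equiv (pkg.decDom.proj x) := fun x => by
    conv_lhs => rw [h]
    rfl
  have hd : ∀ z : pkg.decDom.X₁, pkg.decDom.proj z = z := fun z => by simp
  have hc : ∀ z : pkg.decCodom.X₁, pkg.decCodom.proj z = z := fun z => by simp
  have hq : ∀ y, pkg.quasiInverse y = pkg.equiv.symm (pkg.decCodom.proj y) := fun y => rfl
  refine ⟨pkg.quasiInverse, fun x => ?_, fun y => ?_⟩
  · rw [h' (pkg.quasiInverse _), hq, hd, ContinuousLinearEquiv.apply_symm_apply, h', hc]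
  · rw [hq (u _), h', hc, ContinuousLinearEquiv.symm_apply_apply, hq, hd]

/-- Calderón's formula for the index of an operator invertible modulo nuclear operators. -/
theorem index_eq_trace_sub_trace {u : X →L[ℂ] Y} {v : Y →L[ℂ] X}
    (hvu : IsNuclear (ContinuousLinearMap.id ℂ X - v ∘L u))
    (huv : IsNuclear (ContinuousLinearMap.id ℂ Y - u ∘L v)) :
    (((u : X →ₗ[ℂ] Y).index : ℤ) : ℂ) = trace (ContinuousLinearMap.id ℂ X - v ∘L u) -
      trace (ContinuousLinearMap.id ℂ Y - u ∘L v) := by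
  have hu := isFredholm_of_isNuclear hvu huv
  obtain ⟨w, hw1, hw2⟩ := exists_generalizedInverse hu
  have := hu.finite_ker
  have hco : FiniteDimensional ℂ (Y ⧸ (u : X →ₗ[ℂ] Y).range) := hu.finite_coker
  set P : X →L[ℂ] X := ContinuousLinearMap.id ℂ X - w ∘L u with hPdef
  set Q : Y →L[ℂ] Y := ContinuousLinearMap.id ℂ Y - u ∘L w with hQdef
  have hPr : (P : X →ₗ[ℂ] X).range = (u : X →ₗ[ℂ] Y).ker := by
    ext x
    constructor
    · rintro ⟨z, rfl⟩
      simp [P, hw1]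
    · intro hx
      have hx' : u x = 0 := hx
      exact ⟨x, by simp [P, hx']⟩
  have hQk : (Q : Y →ₗ[ℂ] Y).ker = (u : X →ₗ[ℂ] Y).range := by
    ext y
    constructor
    · intro hy
      have hy' : y - u (w y) = 0 := hy
      exact ⟨w y, (sub_eq_zero.1 hy').symm⟩
    · rintro ⟨z, rfl⟩
      simp [Q, hw1]
  have hQe : (Y ⧸ (u : X →ₗ[ℂ] Y).range) ≃ₗ[ℂ] (Q : Y →ₗ[ℂ] Y).range :=
    (Submodule.quotEquivOfEq _ _ hQk.symm).trans (Q : Y →ₗ[ℂ] Y).quotKerEquivRange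
  have hPf : FiniteDimensional ℂ (P : X →ₗ[ℂ] X).range := by rw [hPr]; infer_instance
  have hQf : FiniteDimensional ℂ (Q : Y →ₗ[ℂ] Y).range := hQe.finiteDimensional
  have hPn := isNuclear_of_finiteDimensional P
  have hQn := isNuclear_of_finiteDimensional Q
  -- Here v - w = v(1 - uw) - (1 - vu)w. Replacing w by v therefore changes the two traces by Tr (v
  -- - w)u and Tr u(v - w), which cancel; for w itself the traces are the dimensions of the kernel
  -- and the cokernel.
  have hd : IsNuclear (v - w) := by
    have h := (hQn.clm_comp v).sub (hvu.comp_clm w)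
    convert h using 1
    ext y; simp [Q]
  have h1 : ContinuousLinearMap.id ℂ X - v ∘L u = P - (v - w) ∘L u := by
    ext x; simp [P]
  have h2 : ContinuousLinearMap.id ℂ Y - u ∘L v = Q - u ∘L (v - w) := by
    ext x; simp [Q]
  rw [h1, h2, trace_sub hPn (hd.comp_clm u), trace_sub hQn (hd.clm_comp u), trace_comp_comm hd,
    trace_of_idempotent P (fun x => by simp [P, hw2]),
    trace_of_idempotent Q (fun x => by simp [Q, hw1]), LinearMap.index_eq_finrank_sub, hPr,
    hQe.finrank_eq]
  push_cast
  ring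

end Calderon

/-! ### Index of a pair of idempotents. -/

section Idempotents

section Ring

variable {R : Type*} [Ring R] {e f : R}

theorem sq_sub_mul_left (he : IsIdempotentElem e) (hf : IsIdempotentElem f) :
    (e - f) ^ 2 * e = e - e * f * e := by
  have he' : ∀ x, e * (e * x) = e * x := fun x => by rw [← mul_assoc, he.eq]
  simp only [sq, sub_mul, mul_sub, mul_assoc, he.eq, hf.eq]
  abel

theorem sq_sub_mul_right (he : IsIdempotentElem e) (hf : IsIdempotentElem f) :
    (e - f) ^ 2 * f = f - f * e * f := by
  have := sq_sub_mul_left hf he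
  rwa [← neg_sub, neg_sq] at this

/-- Both products equal e - efe. The difference e - f itself does not commute with e in general, but
its square does. -/
theorem commute_sq_sub_left (he : IsIdempotentElem e) (hf : IsIdempotentElem f) :
    Commute ((e - f) ^ 2) e := by
  have he' : ∀ x, e * (e * x) = e * x := fun x => by rw [← mul_assoc, he.eq]
  rw [Commute, SemiconjBy, sq_sub_mul_left he hf]
  simp only [sq, sub_mul, mul_sub, mul_assoc, he.eq, hf.eq, he']
  abel

theorem commute_sq_sub_right (he : IsIdempotentElem e) (hf : IsIdempotentElem f) :
    Commute ((e - f) ^ 2) f := by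
  have := commute_sq_sub_left hf he
  rwa [← neg_sub, neg_sq] at this

theorem one_sub_sub_sq (he : IsIdempotentElem e) (hf : IsIdempotentElem f) :
    (1 - e - f) * (1 - e - f) = 1 - (e - f) ^ 2 := by
  simp only [sq, sub_mul, mul_sub, he.eq, hf.eq, mul_one, one_mul]
  abel

theorem anticommute_one_sub_sub (he : IsIdempotentElem e) (hf : IsIdempotentElem f) :
    (e - f) * (1 - e - f) = -((1 - e - f) * (e - f)) := by
  simp only [sub_mul, mul_sub, he.eq, hf.eq, mul_one, one_mul]
  abel

theorem pow_odd_anticommute {a s : R} (h : a * s = -(s * a)) (k : ℕ) :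
    a ^ (2 * k + 1) * s = -(s * a ^ (2 * k + 1)) := by
  have h2 : Commute (a ^ 2) s := by
    rw [Commute, SemiconjBy, sq, mul_assoc, h, mul_neg, ← mul_assoc, h, neg_mul, neg_neg, mul_assoc]
  rw [pow_succ, pow_mul, mul_assoc, h, mul_neg, ← mul_assoc, (h2.pow_left k).eq, mul_assoc]

end Ring

variable {G : Type*} [NormedAddCommGroup G] [InnerProductSpace ℂ G] [CompleteSpace G]

theorem IsNuclear.mul_left {A : G →L[ℂ] G} (hA : IsNuclear A) (B : G →L[ℂ] G) :
    IsNuclear (B * A) := hA.clm_comp B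

theorem IsNuclear.mul_right {A : G →L[ℂ] G} (hA : IsNuclear A) (B : G →L[ℂ] G) :
    IsNuclear (A * B) := hA.comp_clm B

theorem trace_mul_comm {A : G →L[ℂ] G} (hA : IsNuclear A) (B : G →L[ℂ] G) :
    trace (A * B) = trace (B * A) := trace_comp_comm hA B

/-- Let K = E - F and S = 1 - E - F. Then K^(2k+1) - K^(2k+3) = K^(2k+1)S². Moving one S around the
trace and then past the odd power changes the sign, so this trace equals its own negative. -/
theorem trace_pow_odd_succ {E F : G →L[ℂ] G} (hE : IsIdempotentElem E) (hF : IsIdempotentElem F)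
    {k : ℕ} (hK : IsNuclear ((E - F) ^ (2 * k + 1))) :
    trace ((E - F) ^ (2 * (k + 1) + 1)) = trace ((E - F) ^ (2 * k + 1)) := by
  set K := E - F
  set S := 1 - E - F
  have h1 : K ^ (2 * k + 1) * S = -(S * K ^ (2 * k + 1)) :=
    pow_odd_anticommute (anticommute_one_sub_sub hE hF) k
  have h2 : K ^ (2 * k + 1) * S * S = K ^ (2 * k + 1) - K ^ (2 * (k + 1) + 1) := by
    rw [mul_assoc, one_sub_sub_sq hE hF, mul_sub, mul_one, ← pow_add,
      show 2 * (k + 1) + 1 = 2 * k + 1 + 2 by ring]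
  have hK' : IsNuclear (K ^ (2 * (k + 1) + 1)) := by
    rw [show 2 * (k + 1) + 1 = 2 + (2 * k + 1) by ring, pow_add]
    exact hK.mul_left _
  have h3 : trace (K ^ (2 * k + 1) * S * S) = -trace (K ^ (2 * k + 1) * S * S) := by
    conv_lhs => rw [trace_mul_comm (hK.mul_right S), ← mul_assoc, ← neg_eq_iff_eq_neg.2 h1,
      neg_mul, trace_neg]
  have h4 : trace (K ^ (2 * k + 1) * S * S) = 0 := self_eq_neg.1 h3
  rw [h2, trace_sub hK hK', sub_eq_zero] at h4
  exact h4.symm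

theorem completeSpace_range {E : G →L[ℂ] G} (hE : IsIdempotentElem E) :
    CompleteSpace (E : G →ₗ[ℂ] G).range := by
  have h : ((E : G →ₗ[ℂ] G).range : Set G) = {x | E x = x} := by
    ext x
    constructor
    · rintro ⟨z, rfl⟩; exact DFunLike.congr_fun hE.eq z
    · intro hx; exact ⟨x, hx⟩
  have : IsClosed ((E : G →ₗ[ℂ] G).range : Set G) := by
    rw [h]; exact isClosed_eq E.continuous continuous_id
  exact this.completeSpace_coe

/-- The index of a pair of idempotents whose difference has a nuclear odd power. -/
theorem index_idempotents {E F : G →L[ℂ] G} (hE : IsIdempotentElem E) (hF : IsIdempotentElem F)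
    {k : ℕ} (hK : IsNuclear ((E - F) ^ (2 * k + 1)))
    (u : (E : G →ₗ[ℂ] G).range →L[ℂ] (F : G →ₗ[ℂ] G).range) (hu : ∀ x, (u x : G) = F x) :
    u.IsFredholm ∧ (((u : (E : G →ₗ[ℂ] G).range →ₗ[ℂ] (F : G →ₗ[ℂ] G).range).index : ℤ) : ℂ) =
      trace ((E - F) ^ (2 * k + 1)) := by
  have := completeSpace_range hE
  have := completeSpace_range hF
  set K := E - F with hKdef
  let πE : G →L[ℂ] (E : G →ₗ[ℂ] G).range := E.codRestrict _ fun x => ⟨x, rfl⟩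
  let πF : G →L[ℂ] (F : G →ₗ[ℂ] G).range := F.codRestrict _ fun x => ⟨x, rfl⟩
  let ιE : (E : G →ₗ[ℂ] G).range →L[ℂ] G := Submodule.subtypeL _
  let ιF : (F : G →ₗ[ℂ] G).range →L[ℂ] G := Submodule.subtypeL _
  have hιE : ∀ x : (E : G →ₗ[ℂ] G).range, E x = x := by
    rintro ⟨_, z, rfl⟩; exact DFunLike.congr_fun hE.eq z
  have hιF : ∀ x : (F : G →ₗ[ℂ] G).range, F x = x := by
    rintro ⟨_, z, rfl⟩; exact DFunLike.congr_fun hF.eq z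
  -- V inverts 1 - K² up to K^(2(k+1)). As EFE = (1 - K²)E and FEF = (1 - K²)F, the map EV from ran
  -- F to ran E inverts u up to that power.
  set V : G →L[ℂ] G := ∑ j ∈ Finset.range (k + 1), (K ^ 2) ^ j with hV
  have hVE : Commute V E := Commute.sum_left _ _ _ fun j _ =>
    (commute_sq_sub_left hE hF).pow_left j
  have hVF : Commute V F := Commute.sum_left _ _ _ fun j _ =>
    (commute_sq_sub_right hE hF).pow_left j
  have hVK : (1 - K ^ 2) * V = 1 - K ^ (2 * (k + 1)) := by
    rw [hV, mul_neg_geom_sum, pow_mul]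
  have hEV : E * V * F * E = E - K ^ (2 * (k + 1)) * E := by
    have h1 : E * F * E = (1 - K ^ 2) * E := by
      rw [sub_mul, one_mul, sq_sub_mul_left hE hF]; abel
    calc E * V * F * E = E * F * V * E := by rw [mul_assoc E V F, hVF.eq, mul_assoc E F V]
      _ = E * F * E * V := by rw [mul_assoc, hVE.eq, ← mul_assoc]
      _ = (1 - K ^ 2) * V * E := by rw [h1, mul_assoc, mul_assoc, hVE.eq]
      _ = _ := by rw [hVK, sub_mul, one_mul]
  have hFV : F * E * V * F = F - K ^ (2 * (k + 1)) * F := by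
    have h1 : F * E * F = (1 - K ^ 2) * F := by
      rw [sub_mul, one_mul, sq_sub_mul_right hE hF]; abel
    calc F * E * V * F = F * E * F * V := by rw [mul_assoc, hVF.eq, ← mul_assoc]
      _ = (1 - K ^ 2) * V * F := by rw [h1, mul_assoc, mul_assoc, hVF.eq]
      _ = _ := by rw [hVK, sub_mul, one_mul]
  have hcE : Commute (K ^ (2 * (k + 1))) E := by
    rw [pow_mul]; exact (commute_sq_sub_left hE hF).pow_left _
  have hcF : Commute (K ^ (2 * (k + 1))) F := by
    rw [pow_mul]; exact (commute_sq_sub_right hE hF).pow_left _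
  set L := K ^ (2 * (k + 1)) with hL
  have hLn : IsNuclear L := by
    rw [hL, show 2 * (k + 1) = 1 + (2 * k + 1) by ring, pow_add]
    exact hK.mul_left _
  have hvu : ContinuousLinearMap.id ℂ _ - (πE ∘L V ∘L ιF) ∘L u = πE ∘L (L ∘L ιE) := by
    ext x
    have h1 := DFunLike.congr_fun hEV (x : G)
    have h2 := DFunLike.congr_fun hcE.eq (x : G)
    simp only [sub_apply, mul_apply_eq_comp, hιE] at h1 h2
    change (x : G) - E (V (u x : G)) = E (L x)
    rw [hu, h1, ← h2]; abel
  have huv : ContinuousLinearMap.id ℂ _ - u ∘L (πE ∘L V ∘L ιF) = πF ∘L (L ∘L ιF) := by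
    ext x
    have h1 := DFunLike.congr_fun hFV (x : G)
    have h2 := DFunLike.congr_fun hcF.eq (x : G)
    simp only [sub_apply, mul_apply_eq_comp, hιF] at h1 h2
    change (x : G) - (u (πE (V x)) : G) = F (L x)
    rw [hu]
    change (x : G) - F (E (V x)) = F (L x)
    rw [h1, ← h2]; abel
  have hn1 : IsNuclear (πE ∘L (L ∘L ιE)) := (hLn.comp_clm _).clm_comp _
  have hn2 : IsNuclear (πF ∘L (L ∘L ιF)) := (hLn.comp_clm _).clm_comp _
  refine ⟨isFredholm_of_isNuclear (hvu ▸ hn1) (huv ▸ hn2), ?_⟩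
  -- Cyclicity turns the traces on the two ranges into Tr LE and Tr LF on G. Their difference is Tr
  -- LK = Tr K^(2k+3), and the exponent is then lowered by two.
  rw [index_eq_trace_sub_trace (hvu ▸ hn1) (huv ▸ hn2), hvu, huv,
    ← trace_comp_comm (hLn.comp_clm _), ← trace_comp_comm (hLn.comp_clm _),
    ← trace_pow_odd_succ hE hF hK]
  change trace (L * E) - trace (L * F) = _
  rw [← trace_sub (hLn.mul_right _) (hLn.mul_right _), ← mul_sub, hL, ← pow_succ]

end Idempotents

end SigmaTriple

/-! ### Matrices of operators: powers as sums over paths, and traces. -/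

namespace SigmaTriple

section Paths

variable {R ι : Type*} [Ring R] [Fintype ι] [DecidableEq ι]

/-- Here i lists the interior vertices of a path of m + 1 steps from a to b; the induction splits
off the first step. -/
theorem sum_paths_eq_pow (M : Matrix ι ι R) (m : ℕ) (a b : ι) :
    ∑ i : Fin m → ι, (List.ofFn fun k : Fin (m + 1) =>
      M ((Fin.cons a (Fin.snoc i b : Fin (m + 1) → ι) : Fin (m + 2) → ι) k.castSucc)
        ((Fin.cons a (Fin.snoc i b : Fin (m + 1) → ι) : Fin (m + 2) → ι) k.succ)).prod =
      (M ^ (m + 1)) a b := by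
  induction m generalizing a with
  | zero => simp [Fin.snoc]
  | succ m ih =>
    rw [pow_succ', Matrix.mul_apply, ← (Fin.consEquiv fun _ => ι).sum_comp, Fintype.sum_prod_type]
    refine Finset.sum_congr rfl fun c _ => ?_
    rw [← ih, Finset.mul_sum]
    refine Finset.sum_congr rfl fun i _ => ?_
    have h : (Fin.snoc ((Fin.consEquiv fun _ => ι) (c, i)) b : Fin (m + 2) → ι) =
        Fin.cons c (Fin.snoc i b : Fin (m + 1) → ι) := by
      change (Fin.snoc (Fin.cons c i : Fin (m + 1) → ι) b : Fin (m + 2) → ι) = _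
      exact (Fin.cons_snoc_eq_snoc_cons (β := ι) c i b).symm
    rw [h, List.ofFn_succ, List.prod_cons]
    rfl

theorem sum_cycles_eq_sum_pow (M : Matrix ι ι R) (m : ℕ) (a : ι) :
    ∑ i : Fin m → ι, (List.ofFn fun k : Fin (m + 1) =>
      M ((Fin.cons a i : Fin (m + 1) → ι) k) ((Fin.cons a i : Fin (m + 1) → ι) (k + 1))).prod =
      (M ^ (m + 1)) a a := by
  rw [← sum_paths_eq_pow]
  refine Finset.sum_congr rfl fun i _ => ?_
  congr 2
  funext k
  have h1 : (Fin.cons a (Fin.snoc i a : Fin (m + 1) → ι) : Fin (m + 2) → ι) =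
      Fin.snoc (Fin.cons a i : Fin (m + 1) → ι) a :=
    Fin.cons_snoc_eq_snoc_cons (β := ι) a i a
  congr 1
  · rw [h1, Fin.snoc_castSucc (α := fun _ => ι)]
  · rw [Fin.cons_succ]
    induction k using Fin.lastCases with
    -- The cyclic successor of the last index is 0, where the closed path returns to a.
    | last => simp
    | cast j =>
      rw [Fin.snoc_castSucc (α := fun _ => ι), Fin.coeSucc_eq_succ, Fin.cons_succ]

end Paths

section RectOp

variable {E F G : Type*} [NormedAddCommGroup E] [NormedSpace ℂ E]
  [NormedAddCommGroup F] [NormedSpace ℂ F] [NormedAddCommGroup G] [NormedSpace ℂ G] {N : ℕ}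

/-- The operator `E^N → F^N` given by a matrix of operators from `E` to `F`. -/
noncomputable def rectOp (M : Matrix (Fin N) (Fin N) (E →L[ℂ] F)) :
    PiLp 2 (fun _ : Fin N => E) →L[ℂ] PiLp 2 (fun _ : Fin N => F) :=
  ((PiLp.continuousLinearEquiv 2 ℂ (fun _ : Fin N => F)).symm : _ →L[ℂ] _) ∘L
    (ContinuousLinearMap.pi fun i => ∑ j, M i j ∘L ContinuousLinearMap.proj j) ∘L
      ((PiLp.continuousLinearEquiv 2 ℂ (fun _ : Fin N => E)) : _ →L[ℂ] _)

theorem rectOp_apply (M : Matrix (Fin N) (Fin N) (E →L[ℂ] F)) (x : PiLp 2 (fun _ : Fin N => E))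
    (i : Fin N) : rectOp M x i = ∑ j, M i j (x j) := by
  simp [rectOp]

theorem rectOp_diagonal_apply (L : E →L[ℂ] F) (x : PiLp 2 (fun _ : Fin N => E)) (i : Fin N) :
    rectOp (Matrix.diagonal fun _ => L) x i = L (x i) := by
  rw [rectOp_apply, Finset.sum_eq_single i]
  · simp
  · intro j _ hj
    simp [Matrix.diagonal_apply_ne _ hj.symm]
  · simp

theorem matOp_mul (M M' : Matrix (Fin N) (Fin N) (E →L[ℂ] E)) :
    matOp (M * M') = matOp M * matOp M' := by
  ext x i
  simp only [mul_apply_eq_comp, matOp_apply, Matrix.mul_apply, sum_apply, map_sum]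
  exact Finset.sum_comm

theorem matOp_one : matOp (1 : Matrix (Fin N) (Fin N) (E →L[ℂ] E)) = 1 := by
  ext x i
  rw [matOp_apply, Finset.sum_eq_single i]
  · simp
  · intro j _ hj
    simp [Matrix.one_apply_ne hj.symm]
  · simp

theorem matOp_pow (M : Matrix (Fin N) (Fin N) (E →L[ℂ] E)) (k : ℕ) :
    matOp (M ^ k) = matOp M ^ k := by
  induction k with
  | zero => simp [matOp_one]
  | succ k ih => rw [pow_succ, pow_succ, matOp_mul, ih]

theorem matOp_sub (M M' : Matrix (Fin N) (Fin N) (E →L[ℂ] E)) :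
    matOp M - matOp M' = matOp (M - M') := by
  ext x i
  simp [matOp_apply]

/-- The inclusion of the `i`-th summand of `E^N`. -/
noncomputable def inclOp (E : Type*) [NormedAddCommGroup E] [NormedSpace ℂ E] {N : ℕ} (i : Fin N) :
    E →L[ℂ] PiLp 2 (fun _ : Fin N => E) :=
  ((PiLp.continuousLinearEquiv 2 ℂ (fun _ : Fin N => E)).symm : _ →L[ℂ] _) ∘L
    ContinuousLinearMap.single ℂ (fun _ : Fin N => E) i

theorem inclOp_apply (i j : Fin N) (x : E) : inclOp E i x j = if j = i then x else 0 := by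
  simp [inclOp]

theorem matOp_eq_sum (M : Matrix (Fin N) (Fin N) (E →L[ℂ] E)) :
    matOp M = ∑ i, ∑ j, inclOp E i ∘L M i j ∘L PiLp.proj 2 (fun _ : Fin N => E) j := by
  ext x k
  simp only [matOp_apply, sum_apply, ContinuousLinearMap.comp_apply, WithLp.ofLp_sum,
    Finset.sum_apply, inclOp_apply]
  symm
  rw [Finset.sum_eq_single k]
  · simp
  · intro i _ hi
    simp [hi.symm]
  · simp

end RectOp

section TraceMat

variable {E : Type*} [NormedAddCommGroup E] [InnerProductSpace ℂ E] [CompleteSpace E] {N : ℕ}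

theorem isNuclear_matOp {M : Matrix (Fin N) (Fin N) (E →L[ℂ] E)} (h : ∀ i j, IsNuclear (M i j)) :
    IsNuclear (matOp M) := by
  rw [matOp_eq_sum]
  exact isNuclear_sum _ fun i _ => isNuclear_sum _ fun j _ => ((h i j).comp_clm _).clm_comp _

/-- Cyclicity moves each inclusion past its block to the projection, and projection j after
inclusion i is 0 unless i = j, when it is the identity. -/
theorem trace_matOp {M : Matrix (Fin N) (Fin N) (E →L[ℂ] E)} (h : ∀ i j, IsNuclear (M i j)) :
    trace (matOp M) = ∑ i, trace (M i i) := by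
  have h1 : ∀ i j, IsNuclear (inclOp E i ∘L M i j ∘L PiLp.proj 2 (fun _ : Fin N => E) j) :=
    fun i j => ((h i j).comp_clm _).clm_comp _
  rw [matOp_eq_sum, trace_sum _ fun i _ => isNuclear_sum _ fun j _ => h1 i j]
  refine Finset.sum_congr rfl fun i _ => ?_
  rw [trace_sum _ fun j _ => h1 i j, Finset.sum_eq_single i]
  · rw [← trace_comp_comm ((h i i).comp_clm _)]
    congr 1
    ext x
    simp [inclOp_apply]
  · intro j _ hj
    rw [← trace_comp_comm ((h i j).comp_clm _), ← trace_zero (E := E)]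
    congr 1
    ext x
    simp [inclOp_apply, hj]
  · simp

end TraceMat

/-! ### The idempotents of a graded twisted triple and the index formula. -/

namespace GradedSigmaTriple

variable {A H : Type*} [NonUnitalRing A] [Module ℂ A]
  [NormedAddCommGroup H] [InnerProductSpace ℂ H] [CompleteSpace H]
  (T : GradedSigmaTriple A H)

theorem act_add (s : ℤˣ) (a b : A) : T.act s (a + b) = T.act s a + T.act s b := by
  ext x
  change T.π (a + b) x = T.π a x + T.π b x
  simp

theorem act_mul (s : ℤˣ) (a b : A) : T.act s (a * b) = T.act s a * T.act s b := by
  ext x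
  change T.π (a * b) x = T.π a (T.π b x)
  simp

variable {Dinv : H →L[ℂ] H} (hD : IsBoundedInverse T.D Dinv)

/-- The operator `D_±⁻¹ (D_± a_± - σ(a_∓) D_±)`. -/
noncomputable def invComm (s : ℤˣ) (a : A) : T.half s →L[ℂ] T.half s :=
  T.invPart hD s ∘L T.dσ s a

theorem clm_ext_domain (s : ℤˣ) {X : Type*} [NormedAddCommGroup X] [NormedSpace ℂ X]
    {S R : T.half s →L[ℂ] X} (h : ∀ x : (T.DPart s).domain, S x = R x) : S = R :=
  DFunLike.coe_injective <| S.continuous.ext_on (T.dense_domain s) R.continuous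
    fun x hx => h ⟨x, hx⟩

/-- On the domain D⁻¹(Da - σ(a)D) = a - D⁻¹σ(a)D, and bounded operators agreeing on the dense domain
coincide. -/
theorem act_sub_twistedAct (s : ℤˣ) (a : A) :
    T.act s a - T.twistedAct hD s a = T.invComm hD s a := by
  refine T.clm_ext_domain s fun x => ?_
  have h2 := (T.isBoundedInverse_invPart hD s).2 ⟨T.act s a x, T.act_mem_domain s a x x.2⟩
  simp only [invComm, sub_apply, ContinuousLinearMap.comp_apply, T.dσ_apply, map_sub, h2,
    T.twistedAct_apply]

theorem twistedAct_add (s : ℤˣ) (a b : A) :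
    T.twistedAct hD s (a + b) = T.twistedAct hD s a + T.twistedAct hD s b := by
  refine T.clm_ext_domain s fun x => ?_
  simp only [add_apply, T.twistedAct_apply, map_add, act_add]

/-- D⁻¹ takes values in the domain of D, so the inner factor D D⁻¹ cancels in (D⁻¹σ(a)D)(D⁻¹σ(b)D).
-/
theorem twistedAct_mul (s : ℤˣ) (a b : A) :
    T.twistedAct hD s (a * b) = T.twistedAct hD s a * T.twistedAct hD s b := by
  refine T.clm_ext_domain s fun x => ?_
  obtain ⟨h, hy⟩ := (T.isBoundedInverse_invPart hD s).1 (T.act (-s) (T.σ b) (T.DPart s x))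
  have h1 := T.twistedAct_apply hD s a ⟨_, h⟩
  rw [hy] at h1
  rw [mul_apply_eq_comp, T.twistedAct_apply, T.twistedAct_apply, h1, map_mul, act_mul]
  rfl

omit [Module ℂ A] in
theorem isIdempotentElem_matOp_map {E : Type*} [NormedAddCommGroup E] [NormedSpace ℂ E] {N : ℕ}
    {e : Matrix (Fin N) (Fin N) A} (he : IsIdempotentElem e) (φ : A → E →L[ℂ] E)
    (hadd : ∀ a b, φ (a + b) = φ a + φ b) (hmul : ∀ a b, φ (a * b) = φ a * φ b) :
    IsIdempotentElem (matOp (e.map φ)) := by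
  rw [IsIdempotentElem, ← matOp_mul]
  congr 1
  ext1 i j
  have h := congrArg (AddMonoidHom.mk' φ hadd) (congrFun (congrFun he.eq i) j)
  rw [Matrix.mul_apply, map_sum] at h
  rw [Matrix.mul_apply]
  simpa [hmul] using h

theorem isIdempotentElem_matAct (s : ℤˣ) {N : ℕ} {e : Matrix (Fin N) (Fin N) A}
    (he : IsIdempotentElem e) : IsIdempotentElem (T.matAct s e) :=
  isIdempotentElem_matOp_map he _ (T.act_add s) (T.act_mul s)

theorem isIdempotentElem_matTwistedAct (s : ℤˣ) {N : ℕ} {e : Matrix (Fin N) (Fin N) A}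
    (he : IsIdempotentElem e) : IsIdempotentElem (T.matTwistedAct hD s e) :=
  isIdempotentElem_matOp_map he _ (T.twistedAct_add hD s) (T.twistedAct_mul hD s)

theorem matAct_sub_matTwistedAct (s : ℤˣ) {N : ℕ} (e : Matrix (Fin N) (Fin N) A) :
    T.matAct s e - T.matTwistedAct hD s e = matOp (e.map (T.invComm hD s)) := by
  rw [matAct, matTwistedAct, matOp_sub]
  congr 1
  ext1 i j
  exact T.act_sub_twistedAct hD s (e i j)

/-- Exhibiting the component as a compression of D⁻¹ by bounded maps transfers rank decay and
compactness to it. -/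
theorem invPart_eq (s : ℤˣ) : T.invPart hD s =
    (T.half s).orthogonalProjectionOnto ∘L Dinv ∘L (T.half (-s)).subtypeL := by
  ext1 y
  exact ((T.half s).orthogonalProjectionOnto_mem_subspace_eq_self (T.invPart hD s y)).symm

variable {n : ℕ}

theorem hasRankDecay_invComm (hDn : MemWeakSchatten (n : ℝ) Dinv) (s : ℤˣ) (a : A) :
    HasRankDecay (1 / n) (T.invComm hD s a) := by
  obtain ⟨-, C, hC⟩ := hDn
  rw [invComm, invPart_eq]
  exact (((hasRankDecay_of_charValue_le hC).comp_clm _).clm_comp _).comp_clm _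

theorem hasRankDecay_characterOp (hDn : MemWeakSchatten (n : ℝ) Dinv) (s : ℤˣ)
    (a : Fin (n + 1) → A) : HasRankDecay ((n + 1 : ℕ) * (1 / n)) (T.characterOp hD s a) := by
  have h := hasRankDecay_list_prod (p := 1 / n) (by positivity)
    (List.ofFn fun k => T.invComm hD s (a k)) (by simp [List.ofFn_succ]) (by
      intro S hS
      obtain ⟨k, rfl⟩ := (List.mem_ofFn' _ _).1 hS
      exact T.hasRankDecay_invComm hD hDn s _)
  rw [List.length_ofFn] at h
  exact h

/-- This is why n + 1 factors occur: n factors of order 1/n give exponent exactly 1, which is not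
summable. -/
theorem one_lt_decay (hn : 0 < n) : (1 : ℝ) < (n + 1 : ℕ) * (1 / n) := by
  have : (0 : ℝ) < n := by exact_mod_cast hn
  rw [mul_one_div, lt_div_iff₀ this]
  push_cast
  linarith

theorem isNuclear_characterOp (hn : 0 < n) (hDn : MemWeakSchatten (n : ℝ) Dinv) (s : ℤˣ)
    (a : Fin (n + 1) → A) : IsNuclear (T.characterOp hD s a) :=
  (T.hasRankDecay_characterOp hD hDn s a).isNuclear (one_lt_decay hn)

theorem isTraceClass_characterOp (hn : 0 < n) (hDn : MemWeakSchatten (n : ℝ) Dinv) (s : ℤˣ)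
    (a : Fin (n + 1) → A) : IsTraceClass (T.characterOp hD s a) := by
  refine ⟨?_, (T.hasRankDecay_characterOp hD hDn s a).summable_charValue (one_lt_decay hn)⟩
  have h : IsCompactOperator (T.invPart hD s) := by
    rw [invPart_eq]
    exact (hDn.1.comp_clm (T.half (-s)).subtypeL).clm_comp (T.half s).orthogonalProjectionOnto
  rw [characterOp, List.ofFn_succ, List.prod_cons]
  exact (h.comp_clm (T.dσ s (a 0))).comp_clm (List.prod _)

theorem pow_map_invComm_apply (s : ℤˣ) {N : ℕ} (e : Matrix (Fin N) (Fin N) A) (i j : Fin N) :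
    ((e.map (T.invComm hD s)) ^ (n + 1)) i j = ∑ p : Fin n → Fin N,
      T.characterOp hD s fun k : Fin (n + 1) =>
        e ((Fin.cons i (Fin.snoc p j : Fin (n + 1) → Fin N) : Fin (n + 2) → Fin N) k.castSucc)
          ((Fin.cons i (Fin.snoc p j : Fin (n + 1) → Fin N) : Fin (n + 2) → Fin N) k.succ) :=
  (sum_paths_eq_pow (e.map (T.invComm hD s)) n i j).symm

theorem isNuclear_pow_entry (hn : 0 < n) (hDn : MemWeakSchatten (n : ℝ) Dinv) (s : ℤˣ) {N : ℕ}
    (e : Matrix (Fin N) (Fin N) A) (i j : Fin N) :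
    IsNuclear (((e.map (T.invComm hD s)) ^ (n + 1)) i j) := by
  rw [pow_map_invComm_apply]
  exact isNuclear_sum _ fun p _ => T.isNuclear_characterOp hD hn hDn s _

theorem isNuclear_pow (hn : 0 < n) (hDn : MemWeakSchatten (n : ℝ) Dinv) (s : ℤˣ) {N : ℕ}
    (e : Matrix (Fin N) (Fin N) A) :
    IsNuclear ((T.matAct s e - T.matTwistedAct hD s e) ^ (n + 1)) := by
  rw [matAct_sub_matTwistedAct, ← matOp_pow]
  exact isNuclear_matOp fun i j => T.isNuclear_pow_entry hD hn hDn s e i j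

theorem trace_pow_eq_matrixHalfCharacter (hn : 0 < n) (hDn : MemWeakSchatten (n : ℝ) Dinv)
    (s : ℤˣ) {N : ℕ} (e : Matrix (Fin N) (Fin N) A) :
    trace ((T.matAct s e - T.matTwistedAct hD s e) ^ (n + 1)) =
      T.matrixHalfCharacter hD s fun _ : Fin (n + 1) => e := by
  rw [matAct_sub_matTwistedAct, ← matOp_pow,
    trace_matOp fun i j => T.isNuclear_pow_entry hD hn hDn s e i j, matrixHalfCharacter,
    ← (Fin.consEquiv fun _ => Fin N).sum_comp, Fintype.sum_prod_type]
  refine Finset.sum_congr rfl fun a _ => ?_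
  rw [← sum_cycles_eq_sum_pow, trace_sum]
  · rfl
  · intro i _
    exact T.isNuclear_characterOp hD hn hDn s fun k =>
      e ((Fin.cons a i : Fin (n + 1) → Fin N) k) ((Fin.cons a i : Fin (n + 1) → Fin N) (k + 1))

theorem isFredholm_indexOp_and_index_eq_trace (hn : Even n) (hn_pos : 0 < n)
    (hDn : MemWeakSchatten (n : ℝ) Dinv) (s : ℤˣ) {N : ℕ} {e : Matrix (Fin N) (Fin N) A}
    (he : IsIdempotentElem e) :
    (T.indexOp hD s e).IsFredholm ∧ (T.index hD s e : ℂ) =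
      trace ((T.matAct s e - T.matTwistedAct hD s e) ^ (n + 1)) := by
  -- Evenness of n enters here: n + 1 = 2k + 1 is the odd power that `index_idempotents` requires.
  obtain ⟨k, hk⟩ := hn.exists_two_nsmul
  have hK := T.isNuclear_pow hD hn_pos hDn s e
  rw [smul_eq_mul] at hk
  rw [hk] at hK ⊢
  refine index_idempotents (T.isIdempotentElem_matAct s he)
    (T.isIdempotentElem_matTwistedAct hD s he) hK (T.indexOp hD s e) ?_
  rintro ⟨_, z, rfl⟩
  exact congrArg (T.matTwistedAct hD s e)
    (DFunLike.congr_fun (T.isIdempotentElem_matAct s he).eq z)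

end GradedSigmaTriple

end SigmaTriple

/-! ### Adjoints and the comparison of the two indices. -/

namespace SigmaTriple

namespace GradedSigmaTriple

variable {A H : Type*} [NonUnitalRing A] [Module ℂ A]
  [NormedAddCommGroup H] [InnerProductSpace ℂ H] [CompleteSpace H]
  (T : GradedSigmaTriple A H)

/-- The operator `D a - σ(a) D` on the domain of `D`. -/
noncomputable def fullTwistedComm (a : A) : H →ₗ.[ℂ] H where
  domain := T.D.domain
  toFun := T.D.toFun ∘ₗ ((T.π a : H →ₗ[ℂ] H).restrict (T.π_mem_domain a)) -
    (T.π (T.σ a) : H →ₗ[ℂ] H) ∘ₗ T.D.toFun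

/-- The bounded closure of `D a - σ(a) D` on `H`. -/
noncomputable def dOp (a : A) : H →L[ℂ] H :=
  bddClosure (T.fullTwistedComm a)

theorem dOp_apply (a : A) (x : T.D.domain) :
    T.dOp a x = T.D ⟨T.π a x, T.π_mem_domain a x x.2⟩ - T.π (T.σ a) (T.D x) :=
  bddClosure_apply (T.fullTwistedComm a) T.selfAdjoint_D.dense_domain
    (T.bounded_twisted_commutator a) x

/-- Comparing both signs inside H avoids transport between `T.half (-(-s))` and `T.half s`. -/
theorem coe_dσ (s : ℤˣ) (a : A) (x : T.half s) : (T.dσ s a x : H) = T.dOp a x := by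
  have h : (T.half (-s)).subtypeL ∘L T.dσ s a = T.dOp a ∘L (T.half s).subtypeL := by
    refine T.clm_ext_domain s fun x => ?_
    have h1 := T.dOp_apply a ⟨((x : T.half s) : H), x.2⟩
    simp only [ContinuousLinearMap.comp_apply, T.dσ_apply]
    exact h1.symm
  exact DFunLike.congr_fun h x

theorem inner_D_left (x y : T.D.domain) : inner ℂ (T.D x) (y : H) = inner ℂ (x : H) (T.D y) := by
  have h := LinearPMap.adjoint_isFormalAdjoint T.selfAdjoint_D.dense_domain
  rw [show T.D.adjoint = T.D from T.selfAdjoint_D] at h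
  exact h x y

variable {Dinv : H →L[ℂ] H} (hD : IsBoundedInverse T.D Dinv)

include hD

theorem inner_Dinv_left (y z : H) : inner ℂ (Dinv y) z = inner ℂ y (Dinv z) := by
  obtain ⟨h, hy⟩ := hD.1 y
  obtain ⟨h', hz⟩ := hD.1 z
  have := T.inner_D_left ⟨_, h⟩ ⟨_, h'⟩
  rw [hy, hz] at this
  exact this.symm

/-- Formally (D⁻¹d(b))* = (b - D⁻¹σ(b)D)* = b* - Dσ(b)*D⁻¹, and b* = σ(σ(b)*) by the condition on σ,
so this is -d(σ(b)*)D⁻¹. The identity is checked on the domain and extended by density. -/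
theorem inner_Dinv_dOp [StarRing A] (hπ : ∀ a : A, T.π (star a) = star (T.π a))
    (hσ : ∀ a : A, T.σ (star a) = star (T.σ.symm a)) (b : A) (x z : H) :
    inner ℂ (Dinv (T.dOp b x)) z = -inner ℂ x (T.dOp (star (T.σ b)) (Dinv z)) := by
  have hc : T.σ (star (T.σ b)) = star b := by rw [hσ, RingEquiv.symm_apply_apply]
  have hadj : ∀ (a : A) (x y : H), inner ℂ (T.π a x) y = inner ℂ x (T.π (star a) y) :=
      fun a x y => by
    rw [hπ, ContinuousLinearMap.star_eq_adjoint, ContinuousLinearMap.adjoint_inner_right]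
  have key : (fun x : H => inner ℂ (Dinv (T.dOp b x)) z) =
      fun x => -inner ℂ x (T.dOp (star (T.σ b)) (Dinv z)) := by
    refine Continuous.ext_on T.selfAdjoint_D.dense_domain (by fun_prop) (by fun_prop) ?_
    intro x hx
    obtain ⟨h, hz⟩ := hD.1 z
    have h1 := T.dOp_apply b ⟨x, hx⟩
    have h2 := T.dOp_apply (star (T.σ b)) ⟨Dinv z, h⟩
    have h3 := hD.2 ⟨T.π b x, T.π_mem_domain b x hx⟩
    have h4 := T.inner_D_left ⟨x, hx⟩
      ⟨T.π (star (T.σ b)) (Dinv z), T.π_mem_domain (star (T.σ b)) (Dinv z) h⟩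
    simp only at h1 h2 h3 h4 ⊢
    rw [h1, h2, hz, map_sub, h3, inner_sub_left, inner_sub_right, T.inner_Dinv_left hD, hadj, hadj,
      h4, hc]
    ring
  exact congrFun key x

theorem Dinv_mem_half (s : ℤˣ) (y : H) (hy : y ∈ T.half s) : Dinv y ∈ T.half (-s) :=
  (T.invPart hD (-s) ⟨y, by rwa [neg_neg]⟩).2

omit hD in
theorem dOp_mem_half (s : ℤˣ) (a : A) (x : H) (hx : x ∈ T.half (-s)) : T.dOp a x ∈ T.half s := by
  have h := (T.dσ (-s) a ⟨x, hx⟩).2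
  rwa [coe_dσ, neg_neg] at h

omit hD in
/-- The component of the bounded closure of `D a - σ(a) D` from `H_∓` to `H_±`. -/
noncomputable def dOpPart (s : ℤˣ) (a : A) : T.half (-s) →L[ℂ] T.half s :=
  (T.dOp a).restrict (T.dOp_mem_half s a)

/-- The component of `D⁻¹` from `H_±` to `H_∓`. -/
noncomputable def DinvPart (s : ℤˣ) : T.half s →L[ℂ] T.half (-s) :=
  Dinv.restrict (T.Dinv_mem_half hD s)

theorem invComm_neg (s : ℤˣ) (a : A) :
    T.invComm hD (-s) a = T.DinvPart hD s ∘L T.dOpPart s a := by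
  ext x
  change Dinv (T.dσ (-s) a x : H) = Dinv (T.dOp a x)
  rw [coe_dσ]

theorem inner_invComm [StarRing A] (hπ : ∀ a : A, T.π (star a) = star (T.π a))
    (hσ : ∀ a : A, T.σ (star a) = star (T.σ.symm a)) (s : ℤˣ) (b : A) (x z : T.half s) :
    inner ℂ (T.invComm hD s b x) z =
      -inner ℂ x (T.dOpPart s (star (T.σ b)) (T.DinvPart hD s z)) := by
  have h := T.inner_Dinv_dOp hD hπ hσ b x z
  rw [← coe_dσ] at h
  exact h

end GradedSigmaTriple

theorem comp_pow_comp {E F : Type*} [NormedAddCommGroup E] [NormedSpace ℂ E]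
    [NormedAddCommGroup F] [NormedSpace ℂ F] (L : E →L[ℂ] F) (d : F →L[ℂ] E) (k : ℕ) :
    (d ∘L (L ∘L d) ^ k) ∘L L = (d ∘L L) ^ (k + 1) := by
  induction k with
  | zero => ext; simp
  | succ k ih =>
    rw [pow_succ (d ∘L L), ← ih, pow_succ]
    rfl

namespace GradedSigmaTriple

variable {A H : Type*} [NonUnitalRing A] [Module ℂ A]
  [NormedAddCommGroup H] [InnerProductSpace ℂ H] [CompleteSpace H]
  (T : GradedSigmaTriple A H)
variable {Dinv : H →L[ℂ] H} (hD : IsBoundedInverse T.D Dinv)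

theorem matOp_invComm_neg (s : ℤˣ) {N : ℕ} (e : Matrix (Fin N) (Fin N) A) :
    matOp (e.map (T.invComm hD (-s))) =
      rectOp (Matrix.diagonal fun _ => T.DinvPart hD s) ∘L rectOp (e.map (T.dOpPart s)) := by
  ext1 x
  refine PiLp.ext fun i => ?_
  rw [ContinuousLinearMap.comp_apply, matOp_apply, rectOp_diagonal_apply, rectOp_apply, map_sum]
  simp only [Matrix.map_apply, invComm_neg, ContinuousLinearMap.comp_apply]

theorem adjoint_matOp_invComm [StarRing A] (hπ : ∀ a : A, T.π (star a) = star (T.π a))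
    (hσ : ∀ a : A, T.σ (star a) = star (T.σ.symm a)) (s : ℤˣ) {N : ℕ}
    {e : Matrix (Fin N) (Fin N) A} (he : eᴴ = e.map T.σ) :
    (matOp (e.map (T.invComm hD s))).adjoint =
      -(rectOp (e.map (T.dOpPart s)) ∘L rectOp (Matrix.diagonal fun _ => T.DinvPart hD s)) := by
  -- The condition e* = σ(e) says that σ(e_ji)* = e_ij, so the adjoint again involves the entries of
  -- e itself.
  have hstar : ∀ i j, star (T.σ (e j i)) = e i j := fun i j => by
    have := congrFun (congrFun he j) i
    rw [Matrix.conjTranspose_apply, Matrix.map_apply] at this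
    rw [← this, star_star]
  have h : ∀ x y : PiLp 2 fun _ : Fin N => T.half s, inner ℂ (matOp (e.map (T.invComm hD s)) x) y =
      inner ℂ x ((-(rectOp (e.map (T.dOpPart s)) ∘L
        rectOp (Matrix.diagonal fun _ => T.DinvPart hD s))) y) := by
    intro x y
    simp only [PiLp.inner_apply, matOp_apply, neg_apply, ContinuousLinearMap.comp_apply,
      rectOp_apply (e.map _), rectOp_diagonal_apply, sum_inner, inner_sum, inner_neg_right,
      Matrix.map_apply, T.inner_invComm hD hπ hσ, hstar]
    rw [Finset.sum_comm]
    simp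
  have h2 := (ContinuousLinearMap.eq_adjoint_iff _ _).2 h
  rw [h2, ContinuousLinearMap.adjoint_adjoint]

/-- With L for D⁻¹ and d for the twisted commutator of e, the operator is Ld on one half and has
adjoint -dL on the other. Then Tr (Ld)^(k+1) = Tr (dL)^(k+1) by cyclicity, and the sign survives
because k + 1 is odd. -/
theorem trace_pow_neg [StarRing A] (hπ : ∀ a : A, T.π (star a) = star (T.π a))
    (hσ : ∀ a : A, T.σ (star a) = star (T.σ.symm a)) (s : ℤˣ) {N : ℕ}
    {e : Matrix (Fin N) (Fin N) A} (he : eᴴ = e.map T.σ) {k : ℕ} (hk : Even k)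
    (hn : IsNuclear (matOp (e.map (T.invComm hD (-s))) ^ k)) :
    trace (matOp (e.map (T.invComm hD (-s))) ^ (k + 1)) =
      -star (trace (matOp (e.map (T.invComm hD s)) ^ (k + 1))) := by
  have h1 := T.adjoint_matOp_invComm hD hπ hσ s he
  rw [matOp_invComm_neg] at hn ⊢
  set d := rectOp (e.map (T.dOpPart s))
  set L := rectOp (Matrix.diagonal fun _ : Fin N => T.DinvPart hD s)
  set K := matOp (e.map (T.invComm hD s))
  have h2 : (L ∘L d) ^ (k + 1) = L ∘L (d ∘L (L ∘L d) ^ k) := by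
    rw [pow_succ']; rfl
  rw [h2, ← trace_comp_comm (hn.clm_comp d), comp_pow_comp, ← trace_adjoint, ← trace_neg]
  congr 1
  rw [← ContinuousLinearMap.star_eq_adjoint, star_pow, ContinuousLinearMap.star_eq_adjoint, h1,
    hk.add_one.neg_pow, neg_neg]

theorem index_neg_eq [StarRing A] (hπ : ∀ a : A, T.π (star a) = star (T.π a))
    (hσ : ∀ a : A, T.σ (star a) = star (T.σ.symm a)) {n : ℕ} (hn : Even n) (hn_pos : 0 < n)
    (hDn : MemWeakSchatten (n : ℝ) Dinv) (s : ℤˣ) {N : ℕ} {e : Matrix (Fin N) (Fin N) A}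
    (hidem : IsIdempotentElem e) (he : eᴴ = e.map T.σ) :
    T.index hD (-s) e = -T.index hD s e := by
  have key : ∀ s : ℤˣ,
      -- Cyclicity in `trace_pow_neg` needs the next lower power to be nuclear, which decay of order
      -- 1/n does not ensure for the n-th power. The exponent n + 1 is therefore raised to n + 3,
      -- which leaves the trace unchanged.
      (T.index hD s e : ℂ) = trace (matOp (e.map (T.invComm hD s)) ^ (n + 2 + 1)) := by
    intro s
    rw [(T.isFredholm_indexOp_and_index_eq_trace hD hn hn_pos hDn s hidem).2,
      ← matAct_sub_matTwistedAct]
    obtain ⟨k, hk⟩ := hn.exists_two_nsmul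
    have hK := T.isNuclear_pow hD hn_pos hDn s e
    rw [smul_eq_mul] at hk
    rw [hk] at hK ⊢
    exact (trace_pow_odd_succ (T.isIdempotentElem_matAct s hidem)
      (T.isIdempotentElem_matTwistedAct hD s hidem) hK).symm
  have hnuc : IsNuclear (matOp (e.map (T.invComm hD (-s))) ^ (n + 2)) := by
    rw [← matAct_sub_matTwistedAct, pow_succ]
    exact (T.isNuclear_pow hD hn_pos hDn (-s) e).mul_right _
  have h := T.trace_pow_neg hD hπ hσ s he (hn.add (by decide : Even 2)) hnuc
  rw [← key, ← key] at h
  have h2 : (T.index hD (-s) e : ℂ) = ((-T.index hD s e : ℤ) : ℂ) := by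
    rw [h]; simp
  exact_mod_cast h2

end GradedSigmaTriple

end SigmaTriple

theorem mainTheorem2 {A H : Type*} [NonUnitalRing A] [Module ℂ A]
    [IsScalarTower ℂ A A] [SMulCommClass ℂ A A]
    [NormedAddCommGroup H] [InnerProductSpace ℂ H] [CompleteSpace H]
    (T : SigmaTriple.GradedSigmaTriple A H) (n : ℕ) (hn : Even n) (hn_pos : 0 < n)
    (Dinv : H →L[ℂ] H) (hD : SigmaTriple.IsBoundedInverse T.D Dinv)
    (hDn : SigmaTriple.MemWeakSchatten (n : ℝ) Dinv) :
    (∀ s : ℤˣ,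
      (∀ a : Fin (n + 1) → A, SigmaTriple.IsTraceClass (T.characterOp hD s a)) ∧
      ∀ (N : ℕ) (e : Matrix (Fin N) (Fin N) A), IsIdempotentElem e →
        (T.indexOp hD s e).IsFredholm ∧
        (T.index hD s e : ℂ) = T.matrixHalfCharacter hD s (fun _ : Fin (n + 1) => e)) ∧
    (∀ [StarRing A] [StarModule ℂ A],
      (∀ a : A, T.π (star a) = star (T.π a)) →
      (∀ a : A, T.σ (star a) = star (T.σ.symm a)) →
      ∀ (N : ℕ) (e : Matrix (Fin N) (Fin N) A), IsIdempotentElem e → eᴴ = e.map T.σ →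
        T.index hD 1 e = -T.index hD (-1) e) := by
  refine ⟨fun s => ⟨T.isTraceClass_characterOp hD hn_pos hDn s, fun N e he => ?_⟩, ?_⟩
  · rw [← T.trace_pow_eq_matrixHalfCharacter hD hn_pos hDn s e]
    exact T.isFredholm_indexOp_and_index_eq_trace hD hn hn_pos hDn s he
  · intro _ _ hπ hσ N e hidem he
    rw [T.index_neg_eq hD hπ hσ hn hn_pos hDn 1 hidem he, neg_neg]
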